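/- Let $X$ be a complex Banach space of finite cotype, that is, of cotype $q$ for some $2\le q<\infty$, and let $\cot(X)$ be the infimum of all $q\in[2,\infty)$ such that $X$ has cotype $q$. Here $X$ has cotype $q$ if there is a constant $K\ge 1$ such that $\big(\sum_{i=1}^n\|x_i\|^q\big)^{1/q}\le K\big(\mathbb{E}\|\sum_{i=1}^n \varepsilon_i x_i\|^q\big)^{1/q}$ for all $n$ and all $x_1,\dots,x_n\in X$, where $\varepsilon_1,\dots,\varepsilon_n$ are independent Rademacher variables. Let $\xi_0$ be a complex-valued random variable that is symmetric ($\xi_0$ and $-\xi_0$ have the same distribution), non-trivial (not almost surely $0$) and satisfies $\mathbb{E}|\xi_0|^s<\infty$ for some real $s>\cot(X)$, and let $1\le p<s$. Then there is a constant $C\ge 1$ (depending only on $X$, $\xi_0$, $s$, $p$) such that for all $m,n$ and every $m$-homogeneous tetrahedral polynomial $P:\mathbb{C}^n\to X$, $P(z)=\sum_{A\subseteq\{1,\dots,n\},\,|A|=m} x_A\prod_{k\in A}z_k$ with $x_A\in X$, with associated symmetric $m$-linear operator $M:(\mathbb{C}^n)^m\to X$ (the unique symmetric $m$-linear operator with $M(z,\dots,z)=P(z)$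 for all $z\in\mathbb{C}^n$), \[ C^{-m}\big(\mathbb{E}\|P(\xi)\|^p\big)^{1/p}\;\le\; m^{m/2}\big(\mathbb{E}\|M(\xi^{(1)},\dots,\xi^{(m)})\|^p\big)^{1/p}\;\le\; C^{m}\big(\mathbb{E}\|P(\xi)\|^p\big)^{1/p}, \] where $\xi,\xi^{(1)},\dots,\xi^{(m)}$ are independent random vectors in $\mathbb{C}^n$ whose coordinates are independent copies of $\xi_0$ (and $0^0=1$ when $m=0$). -/

import Mathlib

open MeasureTheory ProbabilityTheory
open scoped NNReal ENNReal BigOperators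

/-- `X` has cotype `q`. The uniform average over all sign vectors `ε ∈ {±1}ⁿ` is the expectation
over `n` independent Rademacher variables. -/
def HasCotype (X : Type*) [NormedAddCommGroup X] (q : ℝ) : Prop :=
  2 ≤ q ∧ ∃ C : ℝ, 1 ≤ C ∧ ∀ (n : ℕ) (x : Fin n → X),
    (∑ i, ‖x i‖ ^ q) ^ (1 / q) ≤
      C * (𝔼 ε : Fin n → ℤˣ, ‖∑ i, (ε i : ℤ) • x i‖ ^ q) ^ (1 / q)

/-- `X` has finite (non-trivial) cotype. -/
def HasFiniteCotype (X : Type*) [NormedAddCommGroup X] : Prop :=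
  ∃ q : ℝ, HasCotype X q

/-- `cot(X)`, the infimum of all `q` such that `X` has cotype `q`; the set is bounded below by `2`,
so for spaces of finite cotype this is a genuine infimum. -/
noncomputable def cot (X : Type*) [NormedAddCommGroup X] : ℝ :=
  sInf {q : ℝ | HasCotype X q}

/-- `P : ℂⁿ → X` is an `m`-homogeneous tetrahedral polynomial,
`P(z) = ∑_{|A| = m} x_A ∏_{k ∈ A} z_k`, the sum running over subsets `A` of the index set. -/
def IsTetrahedralHomogeneous {X : Type*} [NormedAddCommGroup X] [NormedSpace ℂ X] {n : ℕ}
    (m : ℕ) (P : (Fin n → ℂ) → X) : Prop :=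
  ∃ x : Finset (Fin n) → X, ∀ z : Fin n → ℂ,
    P z = ∑ A ∈ Finset.powersetCard m Finset.univ, (∏ k ∈ A, z k) • x A

/-- `M` is the symmetric `m`-linear operator associated to `P`. -/
def IsAssociatedSymmetric {X : Type*} [NormedAddCommGroup X] [NormedSpace ℂ X] {n m : ℕ}
    (M : MultilinearMap ℂ (fun _ : Fin m => Fin n → ℂ) X) (P : (Fin n → ℂ) → X) : Prop :=
  (∀ (σ : Equiv.Perm (Fin m)) (z : Fin m → Fin n → ℂ), M (fun l => z (σ l)) = M z) ∧
    ∀ z : Fin n → ℂ, M (fun _ => z) = P z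

/-- `a ≃_K b`: the two quantities are equivalent up to the constant `K`. -/
def EquivUpTo (K a b : ℝ≥0∞) : Prop :=
  K⁻¹ * a ≤ b ∧ b ≤ K * a

/-! Let `ρ` be the law of `ξ₀` and `ρₘ` the law of `m^{-1/2}` times the sum of `m` independent
copies. The auxiliary vector `ζ` with independent coordinates of law `ρₘ` separates the theorem into
an exact decoupling and a change of law.

Decoupling between `ζ` and the copies uses algebra, convexity and symmetry of the law. Polarization
writes `m! M(ξ⁽¹⁾, …, ξ⁽ᵐ⁾)` as a signed average of `P(∑ ± ξ⁽ˡ⁾)`, and each sum is distributed as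
`√m ζ`; this bounds `m! M` by `m^{m/2} P(ζ)` in `L^p` (`lintegral_factorial_decoupled_le`).
Conversely, `M` vanishes on repeated basis vectors because `P` is tetrahedral, so permuting the
copies cyclically and independently in each coordinate and averaging replaces every entry by the
mean of the copies: `P(ζ)` is `m^{m/2}` times an average of variables distributed as the decoupled
form (`lintegral_normalized_le_decoupled`). Since `m^m / m! ≤ e^m`, only exponential factors are
lost.

It remains to exchange `ρ` and `ρₘ` inside `P` at exponential cost. For linear sums this is
`exists_linear_domination`, with a constant that depends on the laws only through an upper bound for
the `s`-th moment and a lower bound for the first; Khintchine makes these bounds uniform in `m`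
(`exists_symmetricLaw_normalizedSum`). The upper estimate is where cotype enters. Cotype `q` bounds
the sum of the `q`-th moments over the classes of a partition, so a random class out of `N` carries
on average a fraction `O(1/N)` of the moment. Independent selectors are dominated by such classes,
and a dyadic decomposition of the multipliers converges because `s > q`. Kahane's inequality returns
to exponent `p`. The lower estimate is Jensen plus contraction.

For degree `m` (`lintegral_polynomial_le`), colour the coordinates with `m` colours and give each
colour its own slot of `M`. This is linear in each colour class, so the law can be changed class by
class at total cost `K^m`. Averaging over colourings recovers `P`, and polarization controls each
coloured term by `P`, again at cost `m^m / m!`. -/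

/-! ### Rademacher averages -/

section Rademacher

variable {X : Type*} [NormedAddCommGroup X] {κ : Type*} [Fintype κ]

/-- The Rademacher sum `∑ᵢ εᵢ xᵢ`. -/
def radSum (x : κ → X) (ε : κ → ℤˣ) : X := ∑ i, (ε i : ℤ) • x i

/-- The `p`-th moment of a Rademacher sum. -/
noncomputable def radMoment [DecidableEq κ] (p : ℝ) (x : κ → X) : ℝ :=
  𝔼 ε : κ → ℤˣ, ‖radSum x ε‖ ^ p

/-- Jensen for subprobability weights: missing mass sits at `0`. This form accommodates partial sums
of geometric weights. -/
theorem rpow_sum_mul_le {J : Type*} (s : Finset J) (w f : J → ℝ) (hw : ∀ j, 0 ≤ w j)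
    (hf : ∀ j, 0 ≤ f j) (hw1 : ∑ j ∈ s, w j ≤ 1) {p : ℝ} (hp : 1 ≤ p) :
    (∑ j ∈ s, w j * f j) ^ p ≤ ∑ j ∈ s, w j * f j ^ p := by
  have h0 : 0 ≤ ∑ j ∈ s, w j * f j ^ p :=
    Finset.sum_nonneg fun j _ => mul_nonneg (hw j) (Real.rpow_nonneg (hf j) _)
  have h := Real.inner_le_weight_mul_Lp_of_nonneg s hp w f hw hf
  have h1 : (∑ j ∈ s, w j) ^ (1 - p⁻¹) ≤ 1 :=
    Real.rpow_le_one (Finset.sum_nonneg fun j _ => hw j) hw1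
      (sub_nonneg.2 (inv_le_one_of_one_le₀ hp))
  calc (∑ j ∈ s, w j * f j) ^ p ≤ ((∑ j ∈ s, w j * f j ^ p) ^ p⁻¹) ^ p := by
        refine Real.rpow_le_rpow (Finset.sum_nonneg fun j _ => mul_nonneg (hw j) (hf j))
          (h.trans ?_) (by linarith)
        exact mul_le_of_le_one_left (Real.rpow_nonneg h0 _) h1
    _ = _ := by rw [← Real.rpow_mul h0, inv_mul_cancel₀ (by linarith), Real.rpow_one]

theorem norm_rpow_sum_smul_le [NormedSpace ℝ X] {J : Type*} (s : Finset J) (w : J → ℝ)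
    (v : J → X) (hw : ∀ j, 0 ≤ w j) (hw1 : ∑ j ∈ s, w j ≤ 1) {p : ℝ} (hp : 1 ≤ p) :
    ‖∑ j ∈ s, w j • v j‖ ^ p ≤ ∑ j ∈ s, w j * ‖v j‖ ^ p := by
  calc ‖∑ j ∈ s, w j • v j‖ ^ p ≤ (∑ j ∈ s, w j * ‖v j‖) ^ p := by
        gcongr
        refine (norm_sum_le _ _).trans (Finset.sum_le_sum fun j _ => ?_)
        rw [norm_smul, Real.norm_of_nonneg (hw j)]
    _ ≤ _ := rpow_sum_mul_le s w _ hw (fun _ => norm_nonneg _) hw1 hp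

theorem radSum_zsmul (x : κ → X) (δ ε : κ → ℤˣ) :
    radSum (fun i => (δ i : ℤ) • x i) ε = radSum x (ε * δ) := by
  simp [radSum, mul_smul]

variable [DecidableEq κ]

theorem radMoment_nonneg (p : ℝ) (x : κ → X) : 0 ≤ radMoment p x :=
  Finset.expect_nonneg fun _ _ => by positivity

theorem radMoment_zsmul (p : ℝ) (x : κ → X) (δ : κ → ℤˣ) :
    radMoment p (fun i => (δ i : ℤ) • x i) = radMoment p x := by
  unfold radMoment
  exact Fintype.expect_equiv (Equiv.mulRight δ) _ _ fun ε => by rw [radSum_zsmul]; rfl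

theorem radMoment_const_smul [NormedSpace ℝ X] (p : ℝ)
    {c : ℝ} (hc : 0 ≤ c) (x : κ → X) :
    radMoment p (fun i => c • x i) = c ^ p * radMoment p x := by
  unfold radMoment radSum
  rw [Finset.mul_expect]
  refine Finset.expect_congr rfl fun ε _ => ?_
  rw [show ∑ i, (ε i : ℤ) • c • x i = c • ∑ i, (ε i : ℤ) • x i by
    rw [Finset.smul_sum]; exact Finset.sum_congr rfl fun i _ => smul_comm _ _ _]
  rw [norm_smul, Real.mul_rpow (norm_nonneg _) (norm_nonneg _), Real.norm_of_nonneg hc]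

theorem radMoment_sum_smul_le [NormedSpace ℝ X] {J : Type*} (s : Finset J) (w : J → ℝ)
    (v : J → κ → X) (hw : ∀ j, 0 ≤ w j) (hw1 : ∑ j ∈ s, w j ≤ 1) {p : ℝ} (hp : 1 ≤ p) :
    radMoment p (fun i => ∑ j ∈ s, w j • v j i) ≤ ∑ j ∈ s, w j * radMoment p (v j) := by
  unfold radMoment
  simp_rw [Finset.mul_expect]
  rw [← Finset.expect_sum_comm]
  refine Finset.expect_le_expect fun ε _ => ?_
  have : radSum (fun i => ∑ j ∈ s, w j • v j i) ε = ∑ j ∈ s, w j • radSum (v j) ε := by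
    simp only [radSum, Finset.smul_sum]
    rw [Finset.sum_comm]
    exact Finset.sum_congr rfl fun j _ => Finset.sum_congr rfl fun i _ => smul_comm _ _ _
  rw [this]
  exact norm_rpow_sum_smul_le s w _ hw hw1 hp

theorem radMoment_update_le [NormedSpace ℝ X] {p : ℝ} (hp : 1 ≤ p) (x : κ → X) (i : κ) {t : ℝ}
    (ht : |t| ≤ 1) : radMoment p (Function.update x i (t • x i)) ≤ radMoment p x := by
  obtain ⟨h1, h2⟩ := abs_le.1 ht
  -- The vector `t xᵢ` is a convex combination of `xᵢ` and `-xᵢ`, and flipping one sign leaves the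
  -- moment unchanged.
  have key := radMoment_sum_smul_le (Finset.univ : Finset (Fin 2)) ![(1 + t) / 2, (1 - t) / 2]
    ![x, fun j => ((Function.update (1 : κ → ℤˣ) i (-1) j : ℤˣ) : ℤ) • x j]
    (by intro j; fin_cases j <;> simp <;> linarith)
    (by rw [Fin.sum_univ_two]; simp only [Matrix.cons_val_zero, Matrix.cons_val_one]; linarith) hp
  rw [Fin.sum_univ_two] at key
  simp only [Matrix.cons_val_zero, Matrix.cons_val_one, radMoment_zsmul] at key
  calc _ = _ := ?_
    _ ≤ _ := key
    _ = radMoment p x := by ring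
  congr 1
  ext j
  rw [Fin.sum_univ_two]
  simp only [Matrix.cons_val_zero, Matrix.cons_val_one]
  by_cases hj : j = i
  · subst hj
    simp only [Function.update_self, Units.val_neg, Units.val_one, neg_smul, one_smul]
    module
  · simp only [Function.update_of_ne hj, Pi.one_apply, Units.val_one, one_smul]
    module

/-- The contraction principle for real multipliers. -/
theorem radMoment_smul_le [NormedSpace ℝ X] {p : ℝ} (hp : 1 ≤ p) (x : κ → X) (t : κ → ℝ)
    (ht : ∀ i, |t i| ≤ 1) : radMoment p (fun i => t i • x i) ≤ radMoment p x := by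
  have key : ∀ s : Finset κ,
      radMoment p (fun i => if i ∈ s then t i • x i else x i) ≤ radMoment p x := by
    intro s
    induction s using Finset.induction_on with
    | empty => simp
    | insert i s hi ih =>
      refine le_trans (le_of_eq ?_) ((radMoment_update_le hp _ i (ht i)).trans ih)
      congr 1
      ext j
      by_cases hj : j = i
      · subst hj; simp [hi]
      · simp [hj]
  simpa using key Finset.univ

theorem radMoment_mono [NormedSpace ℝ X] {p : ℝ} (hp : 1 ≤ p) (x : κ → X) (a b : κ → ℝ)
    (hab : ∀ i, |a i| ≤ b i) :
    radMoment p (fun i => a i • x i) ≤ radMoment p (fun i => b i • x i) := by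
  refine le_trans (le_of_eq ?_) (radMoment_smul_le hp (fun i => b i • x i) (fun i => a i / b i) ?_)
  · congr 1
    ext i
    have h0 : b i = 0 → a i = 0 := fun h => by simpa [h] using hab i
    rw [smul_smul, div_mul_cancel_of_imp h0]
  · intro i
    rw [abs_div]
    exact div_le_one_of_le₀ ((hab i).trans (le_abs_self _)) (abs_nonneg _)

/-- The contraction principle for complex multipliers. -/
theorem radMoment_smul_le_of_norm_le [NormedSpace ℂ X] {p : ℝ} (hp : 1 ≤ p) (x : κ → X)
    (a b : κ → ℂ) (hab : ∀ i, ‖a i‖ ≤ ‖b i‖) :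
    radMoment p (fun i => a i • x i) ≤ 2 ^ p * radMoment p (fun i => b i • x i) := by
  let _ : NormedSpace ℝ X := NormedSpace.complexToReal
  set y : κ → X := fun i => b i • x i with hy
  set t : κ → ℂ := fun i => a i / b i with ht
  have ht1 : ∀ i, ‖t i‖ ≤ 1 := fun i => by
    rw [ht, norm_div]; exact div_le_one_of_le₀ (hab i) (norm_nonneg _)
  -- The complex multiplier is the mean of its doubled real and imaginary parts; the doubling is the
  -- source of `2 ^ p`.
  have hay : (fun i => a i • x i) = fun i => ∑ j : Fin 2, (1 / 2 : ℝ) •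
      (![fun i => (2 * (t i).re) • y i, fun i => (2 * (t i).im) • Complex.I • y i] j i) := by
    ext i
    have h0 : b i = 0 → a i = 0 := fun h => by simpa [h] using hab i
    have : a i • x i = t i • y i := by rw [hy, ht, smul_smul, div_mul_cancel_of_imp h0]
    rw [this, Fin.sum_univ_two]
    simp only [Matrix.cons_val_zero, Matrix.cons_val_one]
    conv_lhs => rw [← Complex.re_add_im (t i)]
    rw [add_smul, mul_smul, Complex.coe_smul, Complex.coe_smul]
    module
  have hI : radMoment p (fun i => Complex.I • y i) = radMoment p y := by
    unfold radMoment radSum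
    refine Finset.expect_congr rfl fun ε _ => ?_
    rw [show ∑ i, (ε i : ℤ) • Complex.I • y i = Complex.I • ∑ i, (ε i : ℤ) • y i by
      rw [Finset.smul_sum]; exact Finset.sum_congr rfl fun i _ => smul_comm _ _ _]
    rw [norm_smul, Complex.norm_I, one_mul]
  have h2 : ∀ z : κ → X, radMoment p (fun i => (2 : ℝ) • z i) = 2 ^ p * radMoment p z :=
    radMoment_const_smul p zero_le_two
  have hre : radMoment p (fun i => (2 * (t i).re) • y i) ≤ 2 ^ p * radMoment p y := by
    rw [← h2]
    refine radMoment_mono hp y _ _ fun i => ?_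
    rw [abs_mul, abs_two]
    linarith [Complex.abs_re_le_norm (t i), ht1 i]
  have him : radMoment p (fun i => (2 * (t i).im) • Complex.I • y i) ≤ 2 ^ p * radMoment p y := by
    rw [← hI, ← h2]
    refine radMoment_mono hp (fun i => Complex.I • y i) _ _ fun i => ?_
    rw [abs_mul, abs_two]
    linarith [Complex.abs_im_le_norm (t i), ht1 i]
  rw [hay]
  refine (radMoment_sum_smul_le Finset.univ (fun _ => (1 / 2 : ℝ)) _ (by simp) (by simp) hp).trans ?_
  rw [Fin.sum_univ_two]
  simp only [Matrix.cons_val_zero, Matrix.cons_val_one]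
  linarith

/-! ### The Kahane inequality -/

theorem expect_units (f : ℤˣ → ℝ) : 𝔼 u, f u = (f 1 + f (-1)) / 2 := by
  rw [Fintype.expect_eq_sum_div_card]
  have : (Finset.univ : Finset ℤˣ) = {1, -1} := by decide
  rw [this, Finset.sum_pair (by decide)]
  simp

theorem expect_fin_succ {n : ℕ} (f : (Fin (n + 1) → ℤˣ) → ℝ) :
    𝔼 ε, f ε = 𝔼 ε : Fin n → ℤˣ, (f (Fin.cons 1 ε) + f (Fin.cons (-1) ε)) / 2 := by
  have : 𝔼 ε, f ε = 𝔼 ε : Fin n → ℤˣ, 𝔼 u : ℤˣ, f (Fin.cons u ε) := by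
    rw [Finset.expect_comm, ← Finset.expect_product' Finset.univ Finset.univ
      (fun (u : ℤˣ) (ε : Fin n → ℤˣ) => f (Fin.cons u ε))]
    exact (Fintype.expect_equiv (Fin.consEquiv fun _ => ℤˣ) _ _ fun _ => rfl).symm
  rw [this]
  exact Finset.expect_congr rfl fun ε _ => expect_units _

/-- The points `x ± y/2` are convex combinations of `x ± y` with weights `3/4, 1/4`. Convexity of
`‖·‖ ^ (p/2)`, where `p ≥ 2` is used, reduces the claim to a quartic inequality in two real numbers.
-/
theorem hypercontractive_two_point [NormedSpace ℝ X] {p : ℝ} (hp : 2 ≤ p) (x y : X) :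
    (‖x + (1 / 2 : ℝ) • y‖ ^ (2 * p) + ‖x - (1 / 2 : ℝ) • y‖ ^ (2 * p)) / 2 ≤
      ((‖x + y‖ ^ p + ‖x - y‖ ^ p) / 2) ^ 2 := by
  have aux : ∀ u v : X, ‖(3 / 4 : ℝ) • u + (1 / 4 : ℝ) • v‖ ^ (2 * p) ≤
      (3 / 4 * ‖u‖ ^ (p / 2) + 1 / 4 * ‖v‖ ^ (p / 2)) ^ 4 := by
    intro u v
    have h := norm_rpow_sum_smul_le (Finset.univ : Finset (Fin 2)) ![(3 / 4 : ℝ), 1 / 4] ![u, v]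
      (by intro j; fin_cases j <;> norm_num) (by rw [Fin.sum_univ_two]; norm_num)
      (p := p / 2) (by linarith)
    simp only [Fin.sum_univ_two, Matrix.cons_val_zero, Matrix.cons_val_one] at h
    calc _ = (‖(3 / 4 : ℝ) • u + (1 / 4 : ℝ) • v‖ ^ (p / 2)) ^ 4 := by
          rw [← Real.rpow_natCast, ← Real.rpow_mul (norm_nonneg _)]; congr 1; push_cast; ring
      _ ≤ _ := by gcongr
  have e1 : x + (1 / 2 : ℝ) • y = (3 / 4 : ℝ) • (x + y) + (1 / 4 : ℝ) • (x - y) := by module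
  have e2 : x - (1 / 2 : ℝ) • y = (3 / 4 : ℝ) • (x - y) + (1 / 4 : ℝ) • (x + y) := by module
  have sq : ∀ u : X, ‖u‖ ^ p = (‖u‖ ^ (p / 2)) ^ 2 := fun u => by
    rw [← Real.rpow_natCast, ← Real.rpow_mul (norm_nonneg _)]; congr 1; push_cast; ring
  rw [e1, e2, sq, sq]
  have h1 := aux (x + y) (x - y)
  have h2 := aux (x - y) (x + y)
  set G := ‖x + y‖ ^ (p / 2)
  set H := ‖x - y‖ ^ (p / 2)
  -- In the variables `G + H` and `G - H` the difference of the two sides is a positive combination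
  -- of the two hints.
  nlinarith [mul_nonneg (sq_nonneg (G + H)) (sq_nonneg (G - H)), sq_nonneg ((G - H) ^ 2)]

/-- Minkowski's inequality in `L²`, in squared form. -/
theorem expect_half_add_sq_le {J : Type*} [Fintype J] (A B : J → ℝ) {a b : ℝ}
    (ha : 0 ≤ a) (hb : 0 ≤ b) (hA : 𝔼 j, A j ^ 2 ≤ a ^ 2) (hB : 𝔼 j, B j ^ 2 ≤ b ^ 2) :
    𝔼 j, ((A j + B j) / 2) ^ 2 ≤ ((a + b) / 2) ^ 2 := by
  have h1 : 𝔼 j, ((A j + B j) / 2) ^ 2 =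
      (1 / 4) * 𝔼 j, A j ^ 2 + (1 / 4) * 𝔼 j, B j ^ 2 + (1 / 2) * 𝔼 j, A j * B j := by
    rw [Finset.mul_expect, Finset.mul_expect, Finset.mul_expect, ← Finset.expect_add_distrib,
      ← Finset.expect_add_distrib]
    exact Finset.expect_congr rfl fun j _ => by ring
  have h2 : 𝔼 j, A j * B j ≤ a * b := by
    refine abs_le_of_sq_le_sq' ?_ (mul_nonneg ha hb) |>.2
    calc _ ≤ _ := Finset.expect_mul_sq_le_sq_mul_sq Finset.univ A B
      _ ≤ a ^ 2 * b ^ 2 := mul_le_mul hA hB (Finset.expect_nonneg fun _ _ => sq_nonneg _)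
          (sq_nonneg _)
      _ = _ := by ring
  rw [h1]
  nlinarith

/-- The two-point inequality tensorizes: it handles the first sign with the others frozen, and
Minkowski combines the induction hypotheses at `x₀ ± x 0`. The offset `x₀` is there for this
induction. -/
theorem hypercontractive_radSum [NormedSpace ℝ X] {p : ℝ} (hp : 2 ≤ p) {n : ℕ} (x₀ : X)
    (x : Fin n → X) :
    𝔼 ε : Fin n → ℤˣ, ‖x₀ + (1 / 2 : ℝ) • radSum x ε‖ ^ (2 * p) ≤
      (𝔼 ε : Fin n → ℤˣ, ‖x₀ + radSum x ε‖ ^ p) ^ 2 := by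
  induction n generalizing x₀ with
  | zero =>
    simp only [radSum, Finset.univ_eq_empty, Finset.sum_empty, smul_zero, add_zero,
      Fintype.expect_const]
    rw [← Real.rpow_natCast, ← Real.rpow_mul (norm_nonneg _), mul_comm]
    simp
  | succ n ih =>
    have hr : ∀ (u : ℤˣ) (ε : Fin n → ℤˣ), radSum x (Fin.cons u ε : Fin (n + 1) → ℤˣ) =
        (u : ℤ) • x 0 + radSum (fun i => x i.succ) ε := by
      intro u ε
      simp [radSum, Fin.sum_univ_succ]
    rw [expect_fin_succ, expect_fin_succ]
    simp only [hr, Units.val_one, Units.val_neg, one_smul, neg_smul]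
    set S : (Fin n → ℤˣ) → X := radSum fun i => x i.succ with hS
    have hA := ih (x₀ + x 0) fun i => x i.succ
    have hB := ih (x₀ - x 0) fun i => x i.succ
    have hlin : 𝔼 ε : Fin n → ℤˣ,
        (‖x₀ + (x 0 + S ε)‖ ^ p + ‖x₀ + (-x 0 + S ε)‖ ^ p) / 2 =
        (𝔼 ε, ‖x₀ + x 0 + S ε‖ ^ p + 𝔼 ε, ‖x₀ - x 0 + S ε‖ ^ p) / 2 := by
      rw [← Finset.expect_add_distrib, Finset.expect_div]
      refine Finset.expect_congr rfl fun ε _ => ?_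
      rw [← add_assoc, ← add_assoc, ← sub_eq_add_neg]
    rw [hlin]
    have hpow : ∀ v : X, ‖v‖ ^ (2 * p) = (‖v‖ ^ p) ^ 2 := fun v => by
      rw [← Real.rpow_natCast, ← Real.rpow_mul (norm_nonneg _)]; congr 1; push_cast; ring
    have nn : ∀ z : X, 0 ≤ 𝔼 ε, ‖z + S ε‖ ^ p := fun z =>
      Finset.expect_nonneg fun _ _ => by positivity
    refine le_trans (Finset.expect_le_expect fun ε _ => ?_) (expect_half_add_sq_le
      (fun ε => ‖x₀ + x 0 + (1 / 2 : ℝ) • S ε‖ ^ p) (fun ε => ‖x₀ - x 0 + (1 / 2 : ℝ) • S ε‖ ^ p)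
      (nn _) (nn _) ?_ ?_)
    · have h := hypercontractive_two_point hp (x₀ + (1 / 2 : ℝ) • S ε) (x 0)
      have e1 : x₀ + (1 / 2 : ℝ) • (x 0 + S ε) = x₀ + (1 / 2 : ℝ) • S ε + (1 / 2 : ℝ) • x 0 := by
        module
      have e2 : x₀ + (1 / 2 : ℝ) • (-x 0 + S ε) = x₀ + (1 / 2 : ℝ) • S ε - (1 / 2 : ℝ) • x 0 := by
        module
      rw [e1, e2, add_right_comm x₀ (x 0), sub_add_eq_add_sub]
      exact h
    · simpa only [← hpow] using hA
    · simpa only [← hpow] using hB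

theorem radMoment_equiv {κ' : Type*} [Fintype κ'] [DecidableEq κ'] (e : κ' ≃ κ) (p : ℝ)
    (x : κ → X) : radMoment p (x ∘ e) = radMoment p x := by
  unfold radMoment radSum
  refine Fintype.expect_equiv (e.arrowCongr (Equiv.refl _)) _ _ fun ε => ?_
  congr 2
  exact Fintype.sum_equiv e _ _ fun i => by simp

theorem radMoment_two_mul_le [NormedSpace ℝ X] {p : ℝ} (hp : 2 ≤ p) (x : κ → X) :
    radMoment (2 * p) x ≤ 4 ^ p * radMoment p x ^ 2 := by
  rw [← radMoment_equiv (Fintype.equivFin κ).symm, ← radMoment_equiv (Fintype.equivFin κ).symm p]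
  have h := hypercontractive_radSum hp 0 (x ∘ (Fintype.equivFin κ).symm)
  have e : ∀ ε, ‖0 + (1 / 2 : ℝ) • radSum (x ∘ (Fintype.equivFin κ).symm) ε‖ ^ (2 * p) =
      (4 ^ p)⁻¹ * ‖radSum (x ∘ (Fintype.equivFin κ).symm) ε‖ ^ (2 * p) := by
    intro ε
    rw [zero_add, norm_smul, Real.mul_rpow (norm_nonneg _) (norm_nonneg _), Real.rpow_mul
      (norm_nonneg (1 / 2 : ℝ)), ← Real.inv_rpow (by norm_num)]
    norm_num
  simp only [e, ← Finset.mul_expect] at h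
  simp only [zero_add] at h
  rwa [inv_mul_le_iff₀ (by positivity)] at h

theorem radMoment_rpow_le (x : κ → X) {p q : ℝ} (hp : 0 < p) (hpq : p ≤ q) :
    radMoment p x ≤ radMoment q x ^ (p / q) := by
  have hq := hp.trans_le hpq
  have key : radMoment p x ^ (q / p) ≤ radMoment q x := by
    unfold radMoment
    rw [Fintype.expect_eq_sum_div_card, Fintype.expect_eq_sum_div_card]
    simp only [div_eq_inv_mul, Finset.mul_sum]
    refine (Real.rpow_arith_mean_le_arith_mean_rpow Finset.univ
      (fun _ => (Fintype.card (κ → ℤˣ) : ℝ)⁻¹) _ (by intros; positivity) ?_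
      (by intros; positivity) (p := p⁻¹ * q) ?_).trans (le_of_eq ?_)
    · simp
    · rw [← div_eq_inv_mul]; exact (one_le_div hp).2 hpq
    · refine Finset.sum_congr rfl fun ε _ => ?_
      rw [← Real.rpow_mul (norm_nonneg _), mul_inv_cancel_left₀ hp.ne']
  calc radMoment p x = (radMoment p x ^ (q / p)) ^ (p / q) := by
        rw [← Real.rpow_mul (radMoment_nonneg _ _), div_mul_div_cancel₀ hp.ne', div_self hq.ne',
          Real.rpow_one]
    _ ≤ _ := Real.rpow_le_rpow (Real.rpow_nonneg (radMoment_nonneg _ _) _) key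
      (by positivity)

/-- Interpolation: with `a, b, c, d` the first four moments, Cauchy–Schwarz gives `b² ≤ a c` and `c²
≤ b d`, and hypercontractivity gives `d ≤ 16 b²`; hence `b⁴ ≤ 16 a² b³`. -/
theorem radMoment_two_le [NormedSpace ℝ X] (x : κ → X) : radMoment 2 x ≤ 16 * radMoment 1 x ^ 2 := by
  have h4 := radMoment_two_mul_le le_rfl x
  have e4 : radMoment (2 * 2) x = 𝔼 ε, ‖radSum x ε‖ ^ 4 :=
    Finset.expect_congr rfl fun ε _ => by rw [← Real.rpow_natCast]; norm_num
  have e2 : radMoment 2 x = 𝔼 ε, ‖radSum x ε‖ ^ 2 :=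
    Finset.expect_congr rfl fun ε _ => by rw [← Real.rpow_natCast]; norm_num
  have e1 : radMoment 1 x = 𝔼 ε, ‖radSum x ε‖ :=
    Finset.expect_congr rfl fun ε _ => by rw [Real.rpow_one]
  rw [e4] at h4
  rw [e2] at h4 ⊢
  rw [e1]
  have c1 := Finset.expect_mul_sq_le_sq_mul_sq Finset.univ (fun ε => √‖radSum x ε‖)
    (fun ε => ‖radSum x ε‖ * √‖radSum x ε‖)
  have c2 := Finset.expect_mul_sq_le_sq_mul_sq Finset.univ (fun ε => ‖radSum x ε‖)
    (fun ε => ‖radSum x ε‖ ^ 2)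
  simp only [mul_pow, Real.sq_sqrt (norm_nonneg _), ← pow_mul, ← pow_succ', ← pow_succ] at c1 c2
  have c1' : (𝔼 ε, ‖radSum x ε‖ ^ 2) ^ 2 ≤ (𝔼 ε, ‖radSum x ε‖) * 𝔼 ε, ‖radSum x ε‖ ^ 3 := by
    have e : ∀ ε, √‖radSum x ε‖ * (‖radSum x ε‖ * √‖radSum x ε‖) = ‖radSum x ε‖ ^ 2 := fun ε => by
      rw [mul_left_comm, Real.mul_self_sqrt (norm_nonneg _), sq]
    simpa only [e] using c1
  norm_num at c2 h4
  have n1 : 0 ≤ 𝔼 ε, ‖radSum x ε‖ := Finset.expect_nonneg fun _ _ => norm_nonneg _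
  have n2 : 0 ≤ 𝔼 ε, ‖radSum x ε‖ ^ 2 := Finset.expect_nonneg fun _ _ => by positivity
  have n3 : 0 ≤ 𝔼 ε, ‖radSum x ε‖ ^ 3 := Finset.expect_nonneg fun _ _ => by positivity
  set a := 𝔼 ε, ‖radSum x ε‖
  set b := 𝔼 ε, ‖radSum x ε‖ ^ 2
  set c := 𝔼 ε, ‖radSum x ε‖ ^ 3
  set d := 𝔼 ε, ‖radSum x ε‖ ^ 4
  rcases n2.eq_or_lt with hb | hb
  · rw [← hb]; positivity
  have h3 : (b ^ 2) ^ 2 ≤ a ^ 2 * (b * (16 * b ^ 2)) :=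
    calc (b ^ 2) ^ 2 ≤ (a * c) ^ 2 := by gcongr
      _ = a ^ 2 * c ^ 2 := by ring
      _ ≤ a ^ 2 * (b * d) := by gcongr
      _ ≤ _ := by gcongr
  have hb3 : 0 < b ^ 3 := by positivity
  refine le_of_mul_le_mul_right ?_ hb3
  nlinarith

/-- The Kahane–Khintchine inequality. -/
theorem exists_radMoment_le_radMoment_one (X : Type*) [NormedAddCommGroup X] [NormedSpace ℝ X]
    {q : ℝ} (hq : 1 ≤ q) :
    ∃ K : ℝ, 0 < K ∧ ∀ (κ : Type) [Fintype κ] [DecidableEq κ] (x : κ → X),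
      radMoment q x ≤ K * radMoment 1 x ^ q := by
  -- Dyadic exponents come by repeated doubling; a general `q` is dominated by the next one.
  have pow2 : ∀ k : ℕ, ∃ K : ℝ, 0 < K ∧ ∀ (κ : Type) [Fintype κ] [DecidableEq κ] (x : κ → X),
      radMoment (2 ^ (k + 1)) x ≤ K * radMoment 1 x ^ (2 ^ (k + 1)) := by
    intro k
    induction k with
    | zero =>
      refine ⟨16, by norm_num, fun κ _ _ x => ?_⟩
      simpa using radMoment_two_le x
    | succ k ih =>
      obtain ⟨K, hK, h⟩ := ih
      refine ⟨4 ^ ((2 : ℝ) ^ (k + 1)) * K ^ 2, by positivity, fun κ _ _ x => ?_⟩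
      rw [pow_succ' (2 : ℝ) (k + 1)]
      have h2 : (2 : ℝ) ≤ 2 ^ (k + 1) := by
        have : (1 : ℝ) ≤ 2 ^ k := one_le_pow₀ (by norm_num)
        rw [pow_succ]; linarith
      refine (radMoment_two_mul_le h2 x).trans ?_
      have := h κ x
      have n := radMoment_nonneg (2 ^ (k + 1)) x
      calc _ ≤ 4 ^ ((2 : ℝ) ^ (k + 1)) * (K * radMoment 1 x ^ 2 ^ (k + 1)) ^ 2 := by gcongr
        _ = _ := by ring
  obtain ⟨k, hk⟩ := pow_unbounded_of_one_lt q (one_lt_two (α := ℝ))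
  obtain ⟨K, hK, h⟩ := pow2 k
  have hk' : q ≤ 2 ^ (k + 1) := hk.le.trans (pow_le_pow_right₀ (by norm_num) (by lia))
  refine ⟨K ^ (q / 2 ^ (k + 1)), by positivity, fun κ _ _ x => ?_⟩
  refine (radMoment_rpow_le x (by linarith) hk').trans ?_
  have n1 := radMoment_nonneg 1 x
  calc _ ≤ (K * radMoment 1 x ^ 2 ^ (k + 1)) ^ (q / 2 ^ (k + 1)) :=
        Real.rpow_le_rpow (radMoment_nonneg _ _) (h κ x) (by positivity)
    _ = _ := by
      rw [Real.mul_rpow hK.le (by positivity), ← Real.rpow_natCast (radMoment 1 x),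
        ← Real.rpow_mul n1]
      congr 2
      push_cast
      field_simp

theorem radMoment_one_rpow_le (x : κ → X) {p : ℝ} (hp : 1 ≤ p) :
    radMoment 1 x ^ p ≤ radMoment p x := by
  have h := radMoment_rpow_le x one_pos hp
  calc radMoment 1 x ^ p ≤ (radMoment p x ^ (1 / p)) ^ p :=
        Real.rpow_le_rpow (radMoment_nonneg _ _) h (by linarith)
    _ = _ := by
      rw [← Real.rpow_mul (radMoment_nonneg _ _), one_div, inv_mul_cancel₀ (by linarith),
        Real.rpow_one]

end Rademacher

/-! ### Replacing the factors of a product measure -/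

section Hybrid

variable {ι : Type*} [DecidableEq ι] {Y : ι → Type*} [∀ i, MeasurableSpace (Y i)]

theorem lmarginal_congr_measure (μ ν : ∀ i, Measure (Y i)) {s : Finset ι}
    (h : ∀ i ∈ s, μ i = ν i) (f : (∀ i, Y i) → ℝ≥0∞) : ∫⋯∫⁻_s, f ∂μ = ∫⋯∫⁻_s, f ∂ν := by
  have : (fun i : s => μ i) = fun i : s => ν i := funext fun i => h i i.2
  ext z
  simp only [lmarginal, this]

theorem lmarginal_const_mul (μ : ∀ i, Measure (Y i)) (s : Finset ι) [∀ i, SigmaFinite (μ i)]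
    (K : ℝ≥0∞) {f : (∀ i, Y i) → ℝ≥0∞} (hf : Measurable f) (z : ∀ i, Y i) :
    (∫⋯∫⁻_s, (fun z => K * f z) ∂μ) z = K * (∫⋯∫⁻_s, f ∂μ) z := by
  simp only [lmarginal]
  rw [lintegral_const_mul]
  exact hf.comp measurable_updateFinset

theorem lmarginal_union_le (μ ν : ∀ i, Measure (Y i)) [∀ i, SigmaFinite (μ i)]
    [∀ i, SigmaFinite (ν i)] {s t : Finset ι} (hst : Disjoint s t) {f : (∀ i, Y i) → ℝ≥0∞}
    (hf : Measurable f) {K L : ℝ≥0∞}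
    (hs : ∀ z, (∫⋯∫⁻_s, f ∂μ) z ≤ K * (∫⋯∫⁻_s, f ∂ν) z)
    (ht : ∀ z, (∫⋯∫⁻_t, f ∂μ) z ≤ L * (∫⋯∫⁻_t, f ∂ν) z) (z : ∀ i, Y i) :
    (∫⋯∫⁻_s ∪ t, f ∂μ) z ≤ K * L * (∫⋯∫⁻_s ∪ t, f ∂ν) z := by
  -- The hybrid family, with `ν` on `s` and `μ` elsewhere, allows Fubini to exchange a `ν`-integral
  -- over `s` with a `μ`-integral over `t`.
  let ρ : ∀ i, Measure (Y i) := fun i => if i ∈ s then ν i else μ i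
  have hρ : ∀ i, SigmaFinite (ρ i) := fun i => by
    by_cases hi : i ∈ s <;> simp only [ρ, hi, if_true, if_false] <;> infer_instance
  have es : ∀ g, ∫⋯∫⁻_s, g ∂ρ = ∫⋯∫⁻_s, g ∂ν :=
    lmarginal_congr_measure ρ ν fun i hi => by simp [ρ, hi]
  have et : ∀ g, ∫⋯∫⁻_t, g ∂ρ = ∫⋯∫⁻_t, g ∂μ :=
    lmarginal_congr_measure ρ μ fun i hi => by simp [ρ, Finset.disjoint_right.1 hst hi]
  calc (∫⋯∫⁻_s ∪ t, f ∂μ) z = (∫⋯∫⁻_t, ∫⋯∫⁻_s, f ∂μ ∂μ) z := by rw [lmarginal_union' μ f hf hst]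
    _ ≤ (∫⋯∫⁻_t, (fun z => K * (∫⋯∫⁻_s, f ∂ν) z) ∂μ) z := lmarginal_mono hs z
    _ = K * (∫⋯∫⁻_t, ∫⋯∫⁻_s, f ∂ν ∂μ) z := lmarginal_const_mul μ t K (hf.lmarginal ν) z
    _ = K * (∫⋯∫⁻_s, ∫⋯∫⁻_t, f ∂μ ∂ν) z := by
      rw [← et, ← es, ← lmarginal_union' ρ f hf hst, lmarginal_union ρ f hf hst, es, et]
    _ ≤ K * (∫⋯∫⁻_s, (fun z => L * (∫⋯∫⁻_t, f ∂ν) z) ∂ν) z := by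
      gcongr; exact lmarginal_mono ht z
    _ = K * L * (∫⋯∫⁻_s ∪ t, f ∂ν) z := by
      rw [lmarginal_const_mul ν s L (hf.lmarginal ν), lmarginal_union ν f hf hst, mul_assoc]

/-- If replacing the factors of a product measure over each fiber of `c` costs at most a factor
`K`, then replacing all of them costs at most `K` to the number of fibers. -/
theorem lintegral_pi_le_of_fibers [Fintype ι] {Λ : Type*} [Fintype Λ] [DecidableEq Λ] (c : ι → Λ)
    (μ ν : ∀ i, Measure (Y i)) [∀ i, IsProbabilityMeasure (μ i)] [∀ i, IsProbabilityMeasure (ν i)]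
    {f : (∀ i, Y i) → ℝ≥0∞} (hf : Measurable f) {K : ℝ≥0∞}
    (h : ∀ l z, (∫⋯∫⁻_{i | c i = l}, f ∂μ) z ≤ K * (∫⋯∫⁻_{i | c i = l}, f ∂ν) z) :
    ∫⁻ z, f z ∂Measure.pi μ ≤ K ^ Fintype.card Λ * ∫⁻ z, f z ∂Measure.pi ν := by
  have key : ∀ T : Finset Λ, ∀ z, (∫⋯∫⁻_{i | c i ∈ T}, f ∂μ) z ≤
      K ^ T.card * (∫⋯∫⁻_{i | c i ∈ T}, f ∂ν) z := by
    intro T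
    induction T using Finset.induction_on with
    | empty => simp
    | insert l T hl ih =>
      intro z
      have e : (Finset.univ.filter fun i => c i ∈ insert l T) =
          (Finset.univ.filter fun i => c i = l) ∪ Finset.univ.filter fun i => c i ∈ T := by
        ext i; simp
      rw [e, Finset.card_insert_of_notMem hl, pow_succ']
      refine lmarginal_union_le μ ν ?_ hf (h l) ih z
      rw [Finset.disjoint_left]
      intro i hi hi'
      simp only [Finset.mem_filter, Finset.mem_univ, true_and] at hi hi'
      exact hl (hi ▸ hi')
  have z₀ : ∀ i, Y i := fun i => (nonempty_of_isProbabilityMeasure (μ i)).some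
  simpa using key Finset.univ z₀

end Hybrid

/-! ### Random selectors and stochastic domination. -/

/-- In a single coordinate the expectation is affine in the success probability, with slope `d ≥ 0`
by monotonicity. Coordinates are replaced one at a time at cost `1`. -/
theorem lintegral_pi_bool_mono {κ : Type*} [Fintype κ] [DecidableEq κ] (μ ν : Measure Bool)
    [IsProbabilityMeasure μ] [IsProbabilityMeasure ν] (h : μ {true} ≤ ν {true})
    {F : (κ → Bool) → ℝ≥0∞} (hF : Monotone F) :
    ∫⁻ b, F b ∂Measure.pi (fun _ => μ) ≤ ∫⁻ b, F b ∂Measure.pi (fun _ => ν) := by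
  have total : ∀ (m : Measure Bool) [IsProbabilityMeasure m], m {true} + m {false} = 1 := by
    intro m _
    have := lintegral_fintype (μ := m) (fun _ : Bool => (1 : ℝ≥0∞))
    rw [lintegral_one, measure_univ, Fintype.sum_bool, one_mul, one_mul] at this
    exact this.symm
  refine (lintegral_pi_le_of_fibers (Y := fun _ => Bool) (fun i : κ => i) (fun _ => μ) (fun _ => ν)
    (f := F) (measurable_of_countable F) (K := 1) fun i z => ?_).trans (by simp)
  rw [one_mul, Finset.filter_eq' Finset.univ i, if_pos (Finset.mem_univ i), lmarginal_singleton,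
    lmarginal_singleton]
  simp only [lintegral_fintype, Fintype.sum_bool]
  obtain ⟨d, hd⟩ := exists_add_of_le (hF (update_le_update_iff.2
    ⟨Bool.false_le true, fun _ _ => le_rfl⟩ :
    Function.update z i false ≤ Function.update z i true))
  have e : ∀ (m : Measure Bool) [IsProbabilityMeasure m],
      F (Function.update z i true) * m {true} + F (Function.update z i false) * m {false} =
      F (Function.update z i false) + d * m {true} := by
    intro m _
    rw [hd, add_mul, add_right_comm, ← mul_add, total, mul_one]
  rw [e, e]
  gcongr

theorem ofReal_expect {J : Type*} [Fintype J] [Nonempty J] {f : J → ℝ} (hf : ∀ j, 0 ≤ f j) :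
    ENNReal.ofReal (𝔼 j, f j) = (Fintype.card J : ℝ≥0∞)⁻¹ * ∑ j, ENNReal.ofReal (f j) := by
  rw [Fintype.expect_eq_sum_div_card, div_eq_inv_mul,
    ENNReal.ofReal_mul (by positivity), ENNReal.ofReal_sum_of_nonneg fun j _ => hf j,
    ENNReal.ofReal_inv_of_pos (by exact_mod_cast Fintype.card_pos), ENNReal.ofReal_natCast]

/-- Random selectors with success probability at most `1 / N` are dominated by the selection of
one class of a uniformly random partition into `N` classes. -/
theorem lintegral_selector_le {κ : Type*} [Fintype κ] [DecidableEq κ] {E : Type*}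
    [MeasurableSpace E] (μ : Measure E) [IsProbabilityMeasure μ] {A : Set E} (hA : MeasurableSet A)
    [DecidablePred (· ∈ A)] (k : ℕ) (hk : μ A ≤ ((k : ℝ≥0∞) + 1)⁻¹) {F : (κ → Bool) → ℝ}
    (hF : Monotone F) (hF0 : ∀ b, 0 ≤ F b) :
    ∫⁻ y, ENNReal.ofReal (F fun i => decide (y i ∈ A)) ∂Measure.pi (fun _ : κ => μ) ≤
      ENNReal.ofReal (𝔼 c : κ → Fin (k + 1), F fun i => decide (c i = 0)) := by
  have hm : Measurable fun y : E => decide (y ∈ A) :=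
    measurable_to_bool (by convert hA using 1; ext; simp)
  -- Membership in class `0` of a uniform colouring is an independent selector of success
  -- probability exactly `1 / (k + 1)`, so monotonicity applies.
  let unif : Measure (Fin (k + 1)) := ((k : ℝ≥0∞) + 1)⁻¹ • Measure.count
  have hunif : IsProbabilityMeasure unif := ⟨by
    simp only [unif, Measure.smul_apply, Measure.count_univ, ENat.card_eq_coe_fintype_card,
      Fintype.card_fin, smul_eq_mul]
    push_cast
    exact ENNReal.inv_mul_cancel (by simp) (by finiteness)⟩
  have hm' : Measurable fun c : Fin (k + 1) => decide (c = 0) := measurable_of_countable _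
  have p1 : IsProbabilityMeasure (μ.map fun y => decide (y ∈ A)) :=
    Measure.isProbabilityMeasure_map hm.aemeasurable
  have p2 : IsProbabilityMeasure (unif.map fun c => decide (c = 0)) :=
    Measure.isProbabilityMeasure_map hm'.aemeasurable
  have hG : Measurable fun b : κ → Bool => ENNReal.ofReal (F b) := measurable_of_countable _
  have e1 : ∫⁻ y, ENNReal.ofReal (F fun i => decide (y i ∈ A)) ∂Measure.pi (fun _ : κ => μ) =
      ∫⁻ b, ENNReal.ofReal (F b) ∂Measure.pi (fun _ : κ => μ.map fun y => decide (y ∈ A)) := by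
    rw [← Measure.pi_map_pi (fun _ => hm.aemeasurable), lintegral_map hG
      (by exact measurable_pi_lambda _ fun i => hm.comp (measurable_pi_apply i))]
  have e2 : ENNReal.ofReal (𝔼 c : κ → Fin (k + 1), F fun i => decide (c i = 0)) =
      ∫⁻ b, ENNReal.ofReal (F b) ∂Measure.pi (fun _ : κ => unif.map fun c => decide (c = 0)) := by
    rw [← Measure.pi_map_pi (fun _ => hm'.aemeasurable), lintegral_map hG (by fun_prop),
      lintegral_fintype, ofReal_expect fun _ => hF0 _, Finset.mul_sum]
    refine Finset.sum_congr rfl fun c _ => ?_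
    rw [Measure.pi_singleton, mul_comm]
    congr 1
    simp [unif, ENNReal.inv_pow]
  rw [e1, e2]
  refine lintegral_pi_bool_mono _ _ ?_ fun b b' h => ENNReal.ofReal_le_ofReal (hF h)
  rw [Measure.map_apply hm (measurableSet_singleton _),
    Measure.map_apply hm' (measurableSet_singleton _)]
  have s1 : (fun y => decide (y ∈ A)) ⁻¹' {true} = A := by ext; simp
  have s2 : (fun c : Fin (k + 1) => decide (c = 0)) ⁻¹' {true} = {0} := by ext; simp
  rw [s1, s2]
  simpa [unif] using hk

/-! ### Random multipliers of Rademacher sums in spaces of finite cotype -/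

section Cotype

variable {X : Type*} [NormedAddCommGroup X]

theorem sum_rpow_le_rpow_sum {J : Type*} (s : Finset J) (a : J → ℝ) (ha : ∀ j, 0 ≤ a j) {t : ℝ}
    (ht : 1 ≤ t) : ∑ j ∈ s, a j ^ t ≤ (∑ j ∈ s, a j) ^ t := by
  have hS : 0 ≤ ∑ j ∈ s, a j := Finset.sum_nonneg fun j _ => ha j
  have split : ∀ b : ℝ, 0 ≤ b → b ^ t = b * b ^ (t - 1) := fun b hb => by
    rw [← Real.rpow_one_add' hb (by linarith)]; congr 1; ring
  rw [split _ hS, Finset.sum_mul]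
  refine Finset.sum_le_sum fun j hj => ?_
  rw [split _ (ha j)]
  exact mul_le_mul_of_nonneg_left (Real.rpow_le_rpow (ha j)
    (Finset.single_le_sum (fun j _ => ha j) hj) (by linarith)) (ha j)

/-- Cotype persists at larger exponents: `ℓ^q` embeds in `ℓ^r`, and moments increase. The root-free
form over arbitrary finite index types is the one used below. -/
theorem HasCotype.exists_sum_le {q r : ℝ} (h : HasCotype X q) (hqr : q ≤ r) :
    ∃ C : ℝ, 1 ≤ C ∧ ∀ (κ : Type) [Fintype κ] [DecidableEq κ] (x : κ → X),
      ∑ i, ‖x i‖ ^ r ≤ C * radMoment r x := by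
  obtain ⟨hq, C, hC, h⟩ := h
  have hq0 : 0 < q := by linarith
  have hr0 : 0 < r := by linarith
  refine ⟨C ^ r, Real.one_le_rpow hC hr0.le, fun κ _ _ x => ?_⟩
  have h1 := h (Fintype.card κ) (x ∘ (Fintype.equivFin κ).symm)
  have e : (𝔼 ε : Fin (Fintype.card κ) → ℤˣ,
      ‖∑ i, (ε i : ℤ) • (x ∘ (Fintype.equivFin κ).symm) i‖ ^ q) = radMoment q x :=
    radMoment_equiv (Fintype.equivFin κ).symm q x
  rw [e, show ∑ i, ‖(x ∘ (Fintype.equivFin κ).symm) i‖ ^ q = ∑ i, ‖x i‖ ^ q from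
    Equiv.sum_comp (Fintype.equivFin κ).symm fun i => ‖x i‖ ^ q] at h1
  have nq := radMoment_nonneg q x
  have nr := radMoment_nonneg r x
  have ns : 0 ≤ ∑ i, ‖x i‖ ^ q := Finset.sum_nonneg fun i _ => by positivity
  calc ∑ i, ‖x i‖ ^ r = ∑ i, (‖x i‖ ^ q) ^ (r / q) :=
        Finset.sum_congr rfl fun i _ => by
          rw [← Real.rpow_mul (norm_nonneg _), mul_div_cancel₀ _ hq0.ne']
    _ ≤ (∑ i, ‖x i‖ ^ q) ^ (r / q) :=
        sum_rpow_le_rpow_sum _ _ (fun i => by positivity) ((one_le_div hq0).2 hqr)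
    _ = ((∑ i, ‖x i‖ ^ q) ^ (1 / q)) ^ r := by rw [← Real.rpow_mul ns]; congr 1; ring
    _ ≤ (C * radMoment q x ^ (1 / q)) ^ r :=
        Real.rpow_le_rpow (Real.rpow_nonneg ns _) h1 hr0.le
    _ ≤ (C * (radMoment r x ^ (q / r)) ^ (1 / q)) ^ r := by
        gcongr
        exact radMoment_rpow_le x hq0 hqr
    _ = C ^ r * radMoment r x := by
        rw [Real.mul_rpow (by linarith) (by positivity), ← Real.rpow_mul nr, ← Real.rpow_mul nr,
          show q / r * (1 / q) * r = 1 by field_simp, Real.rpow_one]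

variable {κ : Type} [Fintype κ] [DecidableEq κ]

/-- For fixed signs `ε`, apply cotype to the vector of class sums with fresh signs `r`. The products
`r (c i) ε i` are again Rademacher signs, so averaging over `ε` restores the full moment. -/
theorem sum_radMoment_class_le {q C : ℝ}
    (hC : ∀ (κ : Type) [Fintype κ] [DecidableEq κ] (x : κ → X), ∑ i, ‖x i‖ ^ q ≤ C * radMoment q x)
    {N : ℕ} (c : κ → Fin N) (x : κ → X) :
    ∑ j, radMoment q (fun i => if c i = j then x i else 0) ≤ C * radMoment q x := by
  have hr : ∀ (ε : κ → ℤˣ) (r : Fin N → ℤˣ),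
      radSum (fun j => radSum (fun i => if c i = j then x i else 0) ε) r =
        radSum (fun i => (r (c i) : ℤ) • x i) ε := by
    intro ε r
    simp only [radSum, Finset.smul_sum]
    rw [Finset.sum_comm]
    refine Finset.sum_congr rfl fun i _ => ?_
    rw [Finset.sum_eq_single (c i)]
    · rw [if_pos rfl, smul_comm]
    · intro j _ hj
      rw [if_neg (Ne.symm hj), smul_zero, smul_zero]
    · simp
  calc ∑ j, radMoment q (fun i => if c i = j then x i else 0)
      = 𝔼 ε : κ → ℤˣ, ∑ j, ‖radSum (fun i => if c i = j then x i else 0) ε‖ ^ q := by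
        rw [Finset.expect_sum_comm]; rfl
    _ ≤ 𝔼 ε : κ → ℤˣ, C *
          radMoment q (fun j => radSum (fun i => if c i = j then x i else 0) ε) :=
        Finset.expect_le_expect fun ε _ => hC _ _
    _ = C * radMoment q x := by
        rw [← Finset.mul_expect]
        congr 1
        unfold radMoment
        simp only [hr]
        rw [Finset.expect_comm]
        have : ∀ r : Fin N → ℤˣ, 𝔼 ε, ‖radSum (fun i => (r (c i) : ℤ) • x i) ε‖ ^ q =
            radMoment q x := fun r => radMoment_zsmul q x (fun i => r (c i))
        simp only [this, Fintype.expect_const]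
        rfl

/-- Under a uniform colouring all `k + 1` classes contribute equally, so each carries that fraction
of the total. -/
theorem expect_radMoment_class_le {q C : ℝ}
    (hC : ∀ (κ : Type) [Fintype κ] [DecidableEq κ] (x : κ → X), ∑ i, ‖x i‖ ^ q ≤ C * radMoment q x)
    (k : ℕ) (x : κ → X) :
    𝔼 c : κ → Fin (k + 1), radMoment q (fun i => if c i = 0 then x i else 0) ≤
      C / (k + 1) * radMoment q x := by
  have hsym : ∀ j : Fin (k + 1), 𝔼 c : κ → Fin (k + 1),
      radMoment q (fun i => if c i = j then x i else 0) =
      𝔼 c : κ → Fin (k + 1), radMoment q (fun i => if c i = 0 then x i else 0) := by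
    intro j
    refine Fintype.expect_equiv ((Equiv.refl κ).arrowCongr (Equiv.swap 0 j)) _ _ fun c => ?_
    congr 1
    ext i
    have : (Equiv.swap 0 j (c i) = 0) ↔ c i = j := by
      rw [Equiv.swap_apply_eq_iff, Equiv.swap_apply_left]
    simp [this]
  have h : (k + 1) * 𝔼 c : κ → Fin (k + 1), radMoment q (fun i => if c i = 0 then x i else 0) =
      𝔼 c : κ → Fin (k + 1), ∑ j, radMoment q (fun i => if c i = j then x i else 0) := by
    rw [Finset.expect_sum_comm]
    simp only [hsym, Finset.sum_const, Finset.card_univ, Fintype.card_fin, nsmul_eq_mul]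
    push_cast
    ring
  have h2 : 𝔼 c : κ → Fin (k + 1), ∑ j, radMoment q (fun i => if c i = j then x i else 0) ≤
      C * radMoment q x :=
    Finset.expect_le Finset.univ_nonempty fun c _ => sum_radMoment_class_le hC c x
  have hk : (0 : ℝ) < k + 1 := by positivity
  rw [div_mul_eq_mul_div, le_div_iff₀ hk, mul_comm, h]
  exact h2

theorem continuous_radMoment {p : ℝ} (hp : 0 ≤ p) :
    Continuous fun x : κ → X => radMoment p x := by
  unfold radMoment radSum
  simp only [Fintype.expect_eq_sum_div_card]
  refine Continuous.div_const (continuous_finsetSum _ fun ε _ => ?_) _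
  exact Continuous.rpow_const (by fun_prop) fun _ => Or.inr hp

/-- Random selectors with success probability at most `t` shrink the `q`-th moment of a Rademacher
sum by a factor of order `t` in spaces of cotype `q`. -/
theorem lintegral_radMoment_selector_le [NormedSpace ℝ X] {q C : ℝ} (hq : 1 ≤ q) (hC1 : 1 ≤ C)
    (hC : ∀ (κ : Type) [Fintype κ] [DecidableEq κ] (x : κ → X), ∑ i, ‖x i‖ ^ q ≤ C * radMoment q x)
    {E : Type*} [MeasurableSpace E] (μ : Measure E) [IsProbabilityMeasure μ] {A : Set E}
    (hA : MeasurableSet A) {t : ℝ} (ht : 0 < t) (hμ : μ A ≤ ENNReal.ofReal t) (x : κ → X) :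
    ∫⁻ y, ENNReal.ofReal (radMoment q fun i => A.indicator (1 : E → ℝ) (y i) • x i)
        ∂Measure.pi (fun _ : κ => μ) ≤ ENNReal.ofReal (2 * C * t * radMoment q x) := by
  classical
  have hn := radMoment_nonneg q x
  -- The number of classes is `k + 1 = ⌊1/t⌋`, or `1` if `t ≥ 1`; rounding to an integer costs the
  -- factor `2`.
  obtain ⟨k, hk1, hk2⟩ : ∃ k : ℕ, μ A ≤ ((k : ℝ≥0∞) + 1)⁻¹ ∧ ((k : ℝ) + 1)⁻¹ ≤ 2 * t := by
    rcases le_or_gt 1 t with h1 | h1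
    · exact ⟨0, by simpa using prob_le_one, by norm_num; linarith⟩
    · have hf : 1 ≤ ⌊t⁻¹⌋₊ := Nat.le_floor (by simpa using (one_le_inv₀ ht).2 h1.le)
      obtain ⟨k, hk⟩ := Nat.exists_eq_add_of_le' hf
      have hle : (k : ℝ) + 1 ≤ t⁻¹ := by
        have := Nat.floor_le (inv_nonneg.2 ht.le)
        rw [hk] at this
        exact_mod_cast this
      have hlt : t⁻¹ < (k : ℝ) + 1 + 1 := by
        have := Nat.lt_floor_add_one t⁻¹
        rw [hk] at this
        exact_mod_cast this
      have hk0 : (0 : ℝ) ≤ k := k.cast_nonneg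
      refine ⟨k, hμ.trans ?_, ?_⟩
      · have : t ≤ ((k : ℝ) + 1)⁻¹ := (le_inv_comm₀ ht (by positivity)).2 hle
        refine (ENNReal.ofReal_le_ofReal this).trans (le_of_eq ?_)
        rw [ENNReal.ofReal_inv_of_pos (by positivity), ENNReal.ofReal_add hk0 zero_le_one]
        simp
      · rw [inv_le_comm₀ (by positivity) (by positivity), mul_inv]
        linarith
  let F : (κ → Bool) → ℝ := fun b => radMoment q fun i => (if b i then (1 : ℝ) else 0) • x i
  have hF : Monotone F := by
    intro b b' hb
    refine radMoment_mono hq x _ _ fun i => ?_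
    have himp := Bool.le_iff_imp.1 (hb i)
    by_cases h : b i = true
    · simp [h, himp h]
    · rw [if_neg h, abs_zero]
      positivity
  have h := lintegral_selector_le μ hA k hk1 hF (fun b => radMoment_nonneg _ _)
  calc _ = ∫⁻ y, ENNReal.ofReal (F fun i => decide (y i ∈ A)) ∂Measure.pi (fun _ : κ => μ) := by
        refine lintegral_congr fun y => ?_
        simp only [F, Set.indicator_apply, Pi.one_apply, decide_eq_true_eq]
    _ ≤ _ := h
    _ ≤ ENNReal.ofReal (C / (k + 1) * radMoment q x) := by
        refine ENNReal.ofReal_le_ofReal ((le_of_eq ?_).trans (expect_radMoment_class_le hC k x))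
        refine Finset.expect_congr rfl fun c _ => ?_
        simp only [F, decide_eq_true_eq, ite_smul, one_smul, zero_smul]
    _ ≤ _ := by
        refine ENNReal.ofReal_le_ofReal (mul_le_mul_of_nonneg_right ?_ hn)
        rw [div_eq_mul_inv]
        calc C * ((k : ℝ) + 1)⁻¹ ≤ C * (2 * t) := by gcongr
          _ = _ := by ring

end Cotype

/-! ### Multipliers with a moment of order above the cotype exponent. -/

section Linear

variable {X : Type*} [NormedAddCommGroup X] [NormedSpace ℂ X]

/-- The dyadic level set used to decompose a random multiplier. -/
def dyadicLevel (B : ℝ) (k : ℕ) : Set ℂ := {y | k = 0 ∨ B * 2 ^ k ≤ 2 * ‖y‖}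

theorem measurableSet_dyadicLevel (B : ℝ) (k : ℕ) : MeasurableSet (dyadicLevel B k) := by
  unfold dyadicLevel
  exact (MeasurableSet.const (k = 0)).union
    (measurableSet_le measurable_const (measurable_norm.const_mul 2))

/-- Take the least `k` with `‖y‖ ≤ B * 2 ^ k`; minimality gives the lower bound unless `k = 0`. -/
theorem exists_mem_dyadicLevel {B : ℝ} (hB : 0 < B) (y : ℂ) :
    ∃ k, y ∈ dyadicLevel B k ∧ ‖y‖ ≤ B * 2 ^ k := by
  have hex : ∃ k : ℕ, ‖y‖ ≤ B * 2 ^ k := by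
    obtain ⟨k, hk⟩ := pow_unbounded_of_one_lt (‖y‖ / B) (one_lt_two (α := ℝ))
    exact ⟨k, by rw [mul_comm]; exact ((div_lt_iff₀ hB).1 hk).le⟩
  classical
  refine ⟨Nat.find hex, ?_, Nat.find_spec hex⟩
  rcases Nat.eq_zero_or_pos (Nat.find hex) with h0 | h0
  · exact Or.inl h0
  · right
    have := Nat.find_min hex (Nat.sub_lt h0 one_pos)
    obtain ⟨j, hj⟩ := Nat.exists_eq_add_of_le' h0
    rw [hj] at this ⊢
    rw [not_le, show j + Nat.succ 0 - 1 = j from rfl] at this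
    rw [pow_succ]
    linarith

/-- Markov's inequality at threshold `B * 2 ^ k / 2`; the halving produces the factor `2 ^ s`. -/
theorem measure_dyadicLevel_le {B s : ℝ} (hB : 0 < B) (hs : 0 < s) (μ : Measure ℂ)
    [IsProbabilityMeasure μ] (hμ : ∫⁻ y, ‖y‖ₑ ^ s ∂μ ≤ ENNReal.ofReal (B ^ s)) (k : ℕ) :
    μ (dyadicLevel B k) ≤ ENNReal.ofReal (2 ^ s * (((2 : ℝ) ^ s) ^ k)⁻¹) := by
  rcases Nat.eq_zero_or_pos k with rfl | hk
  · refine prob_le_one.trans ?_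
    rw [ENNReal.one_le_ofReal]
    simpa using Real.one_le_rpow one_le_two hs.le
  set a : ℝ := B * 2 ^ k / 2 with ha
  have ha0 : 0 < a := by positivity
  have hsub : dyadicLevel B k ⊆ {y | ENNReal.ofReal (a ^ s) ≤ ‖y‖ₑ ^ s} := by
    intro y hy
    have h : a ≤ ‖y‖ := by
      rcases hy with h | h
      · omega
      · rw [ha]; linarith
    rw [Set.mem_ofPred_eq, ← ofReal_norm, ENNReal.ofReal_rpow_of_nonneg (norm_nonneg _) hs.le]
    exact ENNReal.ofReal_le_ofReal (Real.rpow_le_rpow ha0.le h hs.le)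
  have has : 0 < a ^ s := by positivity
  have h := (mul_le_mul_right (measure_mono hsub) (ENNReal.ofReal (a ^ s))).trans
    ((mul_meas_ge_le_lintegral₀ (by fun_prop) _).trans hμ)
  rw [mul_comm, ← ENNReal.le_div_iff_mul_le (by simp [has]) (by simp),
    ← ENNReal.ofReal_div_of_pos has] at h
  refine h.trans (le_of_eq ?_)
  congr 1
  rw [ha, Real.div_rpow (by positivity) (by norm_num), Real.mul_rpow hB.le (by positivity),
    ← Real.rpow_natCast 2 k, ← Real.rpow_natCast (2 ^ s) k, ← Real.rpow_mul (by norm_num),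
    ← Real.rpow_mul (by norm_num), mul_comm s]
  have := Real.rpow_pos_of_pos hB s
  field_simp

/-- The pointwise dyadic bound for a Rademacher sum with multipliers. -/
theorem ofReal_radMoment_le_tsum {κ : Type} [Fintype κ] [DecidableEq κ] {q B : ℝ}
    (hq : 1 ≤ q) (hB : 0 < B) {w : ℕ → ℝ} (hw0 : ∀ k, 0 < w k)
    (hw : ∀ L, ∑ k ∈ Finset.range L, w k ≤ 1) (x : κ → X) (y : κ → ℂ) :
    ENNReal.ofReal (radMoment q fun i => y i • x i) ≤ ∑' k, ENNReal.ofReal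
      (2 ^ q * (w k * (B * 2 ^ k / w k) ^ q)) * ENNReal.ofReal (radMoment q fun i =>
        (dyadicLevel B k).indicator (1 : ℂ → ℝ) (y i) • x i) := by
  choose k hk1 hk2 using exists_mem_dyadicLevel hB
  obtain ⟨L, hL⟩ : ∃ L, ∀ i, k (y i) < L :=
    ⟨Finset.univ.sup (fun i => k (y i)) + 1, fun i =>
      Nat.lt_succ_of_le (Finset.le_sup (f := fun i => k (y i)) (Finset.mem_univ i))⟩
  let R : ℕ → ℝ := fun k => radMoment q fun i =>
    (dyadicLevel B k).indicator (1 : ℂ → ℝ) (y i) • x i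
  have hR : ∀ k, 0 ≤ R k := fun k => radMoment_nonneg _ _
  have h1 : radMoment q (fun i => y i • x i) ≤
      2 ^ q * radMoment q (fun i => ‖y i‖ • x i) := by
    have := radMoment_smul_le_of_norm_le hq x y (fun i => (‖y i‖ : ℂ)) (by simp)
    simpa only [Complex.coe_smul] using this
  have ind0 : ∀ (k : ℕ) (z : ℂ), 0 ≤ (dyadicLevel B k).indicator (1 : ℂ → ℝ) z := fun k z =>
    Set.indicator_nonneg (fun _ _ => zero_le_one) z
  have h2 : radMoment q (fun i => ‖y i‖ • x i) ≤ radMoment q (fun i =>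
      (∑ k ∈ Finset.range L, B * 2 ^ k * (dyadicLevel B k).indicator (1 : ℂ → ℝ) (y i)) • x i) := by
    refine radMoment_mono hq x _ _ fun i => ?_
    rw [abs_of_nonneg (norm_nonneg _)]
    refine le_trans ?_ (Finset.single_le_sum (fun j _ => mul_nonneg (by positivity) (ind0 j _))
      (Finset.mem_range.2 (hL i)))
    rw [Set.indicator_of_mem (hk1 _), Pi.one_apply, mul_one]
    exact hk2 _
  have h3 : radMoment q (fun i =>
      (∑ k ∈ Finset.range L, B * 2 ^ k * (dyadicLevel B k).indicator (1 : ℂ → ℝ) (y i)) • x i) ≤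
      ∑ k ∈ Finset.range L, w k * (B * 2 ^ k / w k) ^ q * R k := by
    -- Jensen with weights `w k`; dividing each level by its weight keeps the sum unchanged.
    have := radMoment_sum_smul_le (Finset.range L) w (fun k i => (B * 2 ^ k / w k) •
      (dyadicLevel B k).indicator (1 : ℂ → ℝ) (y i) • x i) (fun k => (hw0 k).le) (hw L) hq
    refine le_trans (le_of_eq ?_) (this.trans (le_of_eq ?_))
    · congr 1
      ext i
      rw [Finset.sum_smul]
      refine Finset.sum_congr rfl fun k _ => ?_
      rw [smul_smul, smul_smul, mul_div_cancel₀ _ (hw0 k).ne']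
    · refine Finset.sum_congr rfl fun k _ => ?_
      rw [radMoment_const_smul q (div_nonneg (by positivity) (hw0 k).le), mul_assoc]
  calc ENNReal.ofReal (radMoment q fun i => y i • x i)
      ≤ ENNReal.ofReal (∑ k ∈ Finset.range L, 2 ^ q * (w k * (B * 2 ^ k / w k) ^ q) * R k) := by
        refine ENNReal.ofReal_le_ofReal (h1.trans ?_)
        simp only [mul_assoc (2 ^ q : ℝ)]
        rw [← Finset.mul_sum]
        exact mul_le_mul_of_nonneg_left (h2.trans h3) (by positivity)
    _ = ∑ k ∈ Finset.range L, ENNReal.ofReal (2 ^ q * (w k * (B * 2 ^ k / w k) ^ q)) *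
          ENNReal.ofReal (R k) := by
        have hp : ∀ k, 0 ≤ 2 ^ q * (w k * (B * 2 ^ k / w k) ^ q) := fun k => by
          have := hw0 k; positivity
        rw [ENNReal.ofReal_sum_of_nonneg fun k _ => mul_nonneg (hp k) (hR k)]
        exact Finset.sum_congr rfl fun k _ => ENNReal.ofReal_mul (hp k)
    _ ≤ _ := ENNReal.sum_le_tsum _

/-- In a space of cotype `q`, multipliers with bounded moments of an order `s > q` increase the
`q`-th moment of a Rademacher sum at most by a constant factor. -/
theorem exists_lintegral_radMoment_le {q C : ℝ} (hq : 1 ≤ q) (hC1 : 1 ≤ C)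
    (hC : ∀ (κ : Type) [Fintype κ] [DecidableEq κ] (x : κ → X), ∑ i, ‖x i‖ ^ q ≤ C * radMoment q x)
    {s B : ℝ} (hqs : q < s) (hB : 0 < B) :
    ∃ K : ℝ, 0 < K ∧ ∀ (μ : Measure ℂ) [IsProbabilityMeasure μ],
      ∫⁻ y, ‖y‖ₑ ^ s ∂μ ≤ ENNReal.ofReal (B ^ s) →
      ∀ (κ : Type) [Fintype κ] [DecidableEq κ] (x : κ → X),
        ∫⁻ y, ENNReal.ofReal (radMoment q fun i => y i • x i) ∂Measure.pi (fun _ : κ => μ) ≤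
          ENNReal.ofReal (K * radMoment q x) := by
  have hq0 : 0 < q := by linarith
  have hs0 : 0 < s := by linarith
  -- This ratio gives `(2 / r) ^ q = 2 ^ s`: the growth of `(B * 2 ^ k / w k) ^ q` exactly cancels
  -- the Markov decay `2 ^ (-s k)`. The weight `w k`, of order `r ^ k`, remains and is summable
  -- because `q < s`.
  set r : ℝ := 2 ^ (1 - s / q) with hr
  have hr0 : 0 < r := by positivity
  have hr1 : r < 1 := Real.rpow_lt_one_of_one_lt_of_neg one_lt_two
    (sub_neg.2 ((one_lt_div hq0).2 hqs))
  have hr1' : 0 < 1 - r := by linarith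
  have hrs : (2 / r) ^ q = 2 ^ s := by
    have : 2 / r = 2 ^ (s / q) := by
      rw [hr, Real.rpow_sub two_pos, Real.rpow_one]; field_simp
    rw [this, ← Real.rpow_mul two_pos.le, div_mul_cancel₀ _ hq0.ne']
  set w : ℕ → ℝ := fun k => (1 - r) * r ^ k with hw
  have hw0 : ∀ k, 0 < w k := fun k => by positivity
  have hw1 : ∀ L, ∑ k ∈ Finset.range L, w k ≤ 1 := fun L => by
    rw [← Finset.mul_sum, mul_neg_geom_sum]
    linarith [pow_pos hr0 L]
  set D : ℝ := 2 ^ q * ((1 - r) * (B / (1 - r)) ^ q) * (2 * C * 2 ^ s) with hD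
  have hD0 : 0 < D := by positivity
  have hterm : ∀ k, 2 ^ q * (w k * (B * 2 ^ k / w k) ^ q) *
      (2 * C * (2 ^ s * (((2 : ℝ) ^ s) ^ k)⁻¹)) = D * r ^ k := by
    intro k
    have e : B * 2 ^ k / w k = B / (1 - r) * (2 / r) ^ k := by
      simp only [hw]; rw [div_pow]; field_simp
    have e2 : ((2 / r) ^ k) ^ q = (2 ^ s) ^ k := by
      rw [← hrs, ← Real.rpow_natCast, ← Real.rpow_natCast, ← Real.rpow_mul (by positivity),
        ← Real.rpow_mul (by positivity), mul_comm]
    rw [e, Real.mul_rpow (by positivity) (by positivity), e2, hD]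
    simp only [hw]
    have : (0 : ℝ) < (2 ^ s) ^ k := by positivity
    field_simp
  refine ⟨D * (1 - r)⁻¹, by positivity, fun μ _ hμ κ _ _ x => ?_⟩
  have hn := radMoment_nonneg q x
  calc ∫⁻ y, ENNReal.ofReal (radMoment q fun i => y i • x i) ∂Measure.pi (fun _ : κ => μ)
      ≤ ∫⁻ y, ∑' k, ENNReal.ofReal (2 ^ q * (w k * (B * 2 ^ k / w k) ^ q)) *
          ENNReal.ofReal (radMoment q fun i =>
            (dyadicLevel B k).indicator (1 : ℂ → ℝ) (y i) • x i) ∂Measure.pi (fun _ : κ => μ) :=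
        lintegral_mono fun y => ofReal_radMoment_le_tsum hq hB hw0 hw1 x y
    _ = ∑' k, ENNReal.ofReal (2 ^ q * (w k * (B * 2 ^ k / w k) ^ q)) *
          ∫⁻ y, ENNReal.ofReal (radMoment q fun i =>
            (dyadicLevel B k).indicator (1 : ℂ → ℝ) (y i) • x i) ∂Measure.pi (fun _ : κ => μ) := by
        have hmeas : ∀ k, Measurable fun y : κ → ℂ => ENNReal.ofReal (radMoment q fun i =>
            (dyadicLevel B k).indicator (1 : ℂ → ℝ) (y i) • x i) := by
          intro k
          have hc : Continuous fun a : κ → ℝ => radMoment q fun i => a i • x i :=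
            (continuous_radMoment hq0.le).comp (by fun_prop)
          refine ENNReal.measurable_ofReal.comp (hc.measurable.comp
            (measurable_pi_lambda _ fun i => ?_))
          exact (measurable_one.indicator (measurableSet_dyadicLevel B k)).comp
            (measurable_pi_apply i)
        rw [lintegral_tsum fun k => ((hmeas k).const_mul _).aemeasurable]
        exact tsum_congr fun k => lintegral_const_mul _ (hmeas k)
    _ ≤ ∑' k, ENNReal.ofReal (2 ^ q * (w k * (B * 2 ^ k / w k) ^ q)) *
          ENNReal.ofReal (2 * C * (2 ^ s * (((2 : ℝ) ^ s) ^ k)⁻¹) * radMoment q x) := by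
        gcongr with k
        exact lintegral_radMoment_selector_le hq hC1 hC μ (measurableSet_dyadicLevel B k)
          (by positivity) (measure_dyadicLevel_le hB hs0 μ hμ k) x
    _ = ∑' k, ENNReal.ofReal (D * radMoment q x * r ^ k) := by
        refine tsum_congr fun k => ?_
        have := hw0 k
        rw [← ENNReal.ofReal_mul (by positivity), ← mul_assoc, hterm, mul_right_comm]
    _ = ENNReal.ofReal (D * (1 - r)⁻¹ * radMoment q x) := by
        rw [← ENNReal.ofReal_tsum_of_nonneg (fun k => by positivity)
          ((summable_geometric_of_lt_one hr0.le hr1).mul_left _), tsum_mul_left,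
          tsum_geometric_of_lt_one hr0.le hr1, mul_right_comm]

/-- Multipliers with a first moment bounded below do not decrease the moments of a Rademacher
sum by more than a constant factor. -/
theorem ofReal_radMoment_le_lintegral {p c : ℝ} (hp : 1 ≤ p) (hc : 0 < c) (μ : Measure ℂ)
    [IsProbabilityMeasure μ] (hint : Integrable (fun y : ℂ => ‖y‖) μ) (hμ : c ≤ ∫ y, ‖y‖ ∂μ)
    {κ : Type} [Fintype κ] [DecidableEq κ] (x : κ → X) :
    ENNReal.ofReal (radMoment p x) ≤ ENNReal.ofReal ((2 / c) ^ p) *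
      ∫⁻ y, ENNReal.ofReal (radMoment p fun i => y i • x i) ∂Measure.pi (fun _ : κ => μ) := by
  let _ : NormedSpace ℝ X := NormedSpace.complexToReal
  let g : (κ → ℝ) → ℝ := fun a => radMoment p fun i => a i • x i
  have hgc : Continuous g := (continuous_radMoment (by linarith)).comp (by fun_prop)
  have hg0 : ∀ a, 0 ≤ g a := fun a => radMoment_nonneg _ _
  -- Convexity permits Jensen at the mean of `‖y i‖`, where every multiplier is at least `c`.
  have hgx : ConvexOn ℝ Set.univ g := by
    refine ⟨convex_univ, fun a _ b _ u v hu hv huv => ?_⟩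
    have := radMoment_sum_smul_le (Finset.univ : Finset (Fin 2)) ![u, v]
      ![fun i => a i • x i, fun i => b i • x i]
      (by intro j; fin_cases j <;> assumption) (by rw [Fin.sum_univ_two]; exact huv.le) hp
    simp only [Fin.sum_univ_two, Matrix.cons_val_zero, Matrix.cons_val_one] at this
    refine le_trans (le_of_eq ?_) this
    simp only [g]
    congr 1
    ext i
    simp [add_smul, mul_smul]
  set m := Measure.pi (fun _ : κ => μ)
  let f : (κ → ℂ) → κ → ℝ := fun y i => ‖y i‖
  have hfi : ∀ i, Integrable (fun y => f y i) m := fun i =>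
    integrable_comp_eval (μ := fun _ : κ => μ) (i := i) hint
  have hfm : ∫ y, f y ∂m = fun _ => ∫ y, ‖y‖ ∂μ := by
    ext i
    rw [eval_integral hfi]
    exact integral_comp_eval (μ := fun _ : κ => μ) (i := i) hint.aestronglyMeasurable
  have h1 : c ^ p * radMoment p x ≤ g (∫ y, f y ∂m) := by
    rw [hfm, ← radMoment_const_smul p hc.le]
    exact radMoment_mono hp x _ _ fun i => by rwa [abs_of_pos hc]
  have h2 : ENNReal.ofReal (g (∫ y, f y ∂m)) ≤ ∫⁻ y, ENNReal.ofReal (g (f y)) ∂m := by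
    by_cases hi : Integrable (g ∘ f) m
    · refine le_trans ?_ (ofReal_integral_eq_lintegral_ofReal hi
        (Filter.Eventually.of_forall fun y => hg0 _)).le
      exact ENNReal.ofReal_le_ofReal (hgx.map_integral_le hgc.continuousOn isClosed_univ
        (by simp) (Integrable.of_eval hfi) hi)
    · have hm : AEStronglyMeasurable (g ∘ f) m :=
        (hgc.comp (by fun_prop : Continuous f)).aestronglyMeasurable
      have : ∫⁻ y, ENNReal.ofReal (g (f y)) ∂m = ∞ := by
        by_contra hne
        exact hi ⟨hm, (hasFiniteIntegral_iff_ofReal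
          (Filter.Eventually.of_forall fun y => hg0 _)).2 (lt_top_iff_ne_top.2 hne)⟩
      rw [this]
      exact le_top
  have h3 : ∀ y : κ → ℂ, g (f y) ≤ 2 ^ p * radMoment p fun i => y i • x i := by
    intro y
    have := radMoment_smul_le_of_norm_le hp x (fun i => (‖y i‖ : ℂ)) y (by simp)
    simpa only [Complex.coe_smul] using this
  have hcp : 0 < c ^ p := by positivity
  have h4 : ENNReal.ofReal (c ^ p * radMoment p x) ≤ ENNReal.ofReal (2 ^ p) *
      ∫⁻ y, ENNReal.ofReal (radMoment p fun i => y i • x i) ∂m := by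
    rw [← lintegral_const_mul' _ _ (by simp)]
    refine (ENNReal.ofReal_le_ofReal h1).trans (h2.trans (lintegral_mono fun y => ?_))
    rw [← ENNReal.ofReal_mul (by positivity)]
    exact ENNReal.ofReal_le_ofReal (h3 y)
  have e : ENNReal.ofReal (radMoment p x) = ENNReal.ofReal (c ^ p)⁻¹ *
      ENNReal.ofReal (c ^ p * radMoment p x) := by
    rw [← ENNReal.ofReal_mul (by positivity), inv_mul_cancel_left₀ hcp.ne']
  rw [e, Real.div_rpow (by norm_num) hc.le, div_eq_inv_mul,
    ENNReal.ofReal_mul (p := (c ^ p)⁻¹) (by positivity), mul_assoc]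
  gcongr

end Linear

/-! ### Comparison of sums of independent symmetric multiples of fixed vectors -/

section Domination

variable {X : Type*} [NormedAddCommGroup X] [NormedSpace ℂ X]

theorem measurePreserving_units_zsmul {μ : Measure ℂ} (hμ : MeasurePreserving (fun y => -y) μ μ)
    (u : ℤˣ) : MeasurePreserving (fun y : ℂ => (u : ℤ) • y) μ μ := by
  rcases Int.units_eq_one_or u with rfl | rfl
  · simp only [Units.val_one, one_smul]
    exact MeasurePreserving.id μ
  · simpa using hμ

theorem measurePreserving_pi_zsmul {κ : Type*} [Fintype κ] {μ : Measure ℂ} [SigmaFinite μ]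
    (hμ : MeasurePreserving (fun y => -y) μ μ) (ε : κ → ℤˣ) :
    MeasurePreserving (fun (y : κ → ℂ) i => (ε i : ℤ) • y i) (Measure.pi fun _ => μ)
      (Measure.pi fun _ => μ) :=
  measurePreserving_pi _ _ fun i => measurePreserving_units_zsmul hμ (ε i)

theorem ofReal_norm_rpow {E : Type*} [NormedAddCommGroup E] (v : E) {p : ℝ} (hp : 0 ≤ p) :
    ENNReal.ofReal (‖v‖ ^ p) = ‖v‖ₑ ^ p := by
  rw [← ofReal_norm, ENNReal.ofReal_rpow_of_nonneg (norm_nonneg _) hp]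

/-- Symmetrization: inserting Rademacher signs. -/
theorem lintegral_enorm_sum_rpow {κ : Type*} [Fintype κ] [DecidableEq κ] {μ : Measure ℂ}
    [IsProbabilityMeasure μ] (hμ : MeasurePreserving (fun y => -y) μ μ) {p : ℝ} (hp : 0 ≤ p)
    (x : κ → X) :
    ∫⁻ y, ‖∑ i, y i • x i‖ₑ ^ p ∂Measure.pi (fun _ : κ => μ) =
      ∫⁻ y, ENNReal.ofReal (radMoment p fun i => y i • x i) ∂Measure.pi (fun _ : κ => μ) := by
  have hf : Measurable fun y : κ → ℂ => ‖∑ i, y i • x i‖ₑ ^ p := by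
    have : Continuous fun y : κ → ℂ => ∑ i, y i • x i := by fun_prop
    exact this.enorm.measurable.pow_const p
  have e : ∀ y : κ → ℂ, ENNReal.ofReal (radMoment p fun i => y i • x i) =
      (Fintype.card (κ → ℤˣ) : ℝ≥0∞)⁻¹ * ∑ ε : κ → ℤˣ, ‖∑ i, ((ε i : ℤ) • y i) • x i‖ₑ ^ p := by
    intro y
    unfold radMoment
    rw [ofReal_expect fun ε => by positivity]
    congr 1
    refine Finset.sum_congr rfl fun ε _ => ?_
    rw [ofReal_norm_rpow _ hp]
    simp only [radSum, smul_assoc]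
  simp only [e]
  have hm : ∀ ε : κ → ℤˣ, Measurable fun y : κ → ℂ => ‖∑ i, ((ε i : ℤ) • y i) • x i‖ₑ ^ p :=
    fun ε => hf.comp (measurePreserving_pi_zsmul hμ ε).measurable
  rw [lintegral_const_mul _ (Finset.measurable_sum _ fun ε _ => hm ε),
    lintegral_finsetSum _ fun ε _ => hm ε]
  have : ∀ ε : κ → ℤˣ, ∫⁻ y, ‖∑ i, ((ε i : ℤ) • y i) • x i‖ₑ ^ p ∂Measure.pi (fun _ : κ => μ) =
      ∫⁻ y, ‖∑ i, y i • x i‖ₑ ^ p ∂Measure.pi (fun _ : κ => μ) :=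
    fun ε => (measurePreserving_pi_zsmul hμ ε).lintegral_comp hf
  simp only [this, Finset.sum_const, nsmul_eq_mul, Finset.card_univ]
  rw [← mul_assoc, ENNReal.inv_mul_cancel (by simp) (by simp), one_mul]

/-- Symmetric laws with quantitative bounds on the `s`-th moment from above and on the first
moment from below. -/
structure SymmetricLaw (s B c : ℝ) (μ : Measure ℂ) : Prop where
  neg : MeasurePreserving (fun y => -y) μ μ
  moment_le : ∫⁻ y, ‖y‖ₑ ^ s ∂μ ≤ ENNReal.ofReal (B ^ s)
  le_moment : ENNReal.ofReal c ≤ ∫⁻ y, ‖y‖ₑ ∂μ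

theorem lintegral_rpow_le_rpow_lintegral {α : Type*} [MeasurableSpace α] (μ : Measure α)
    [IsProbabilityMeasure μ] {f : α → ℝ≥0∞} (hf : AEMeasurable f μ) {t : ℝ} (ht0 : 0 < t)
    (ht : t ≤ 1) : ∫⁻ a, f a ^ t ∂μ ≤ (∫⁻ a, f a ∂μ) ^ t := by
  have h := eLpNorm'_le_eLpNorm'_of_exponent_le (f := f) ht0 ht μ hf.aestronglyMeasurable
  simp only [eLpNorm', enorm_eq_self, ENNReal.rpow_one, one_div, inv_one] at h
  calc ∫⁻ a, f a ^ t ∂μ = ((∫⁻ a, f a ^ t ∂μ) ^ t⁻¹) ^ t := by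
        rw [← ENNReal.rpow_mul, inv_mul_cancel₀ ht0.ne', ENNReal.rpow_one]
    _ ≤ _ := ENNReal.rpow_le_rpow h ht0.le

theorem SymmetricLaw.integrable {s B c : ℝ} {μ : Measure ℂ} [IsProbabilityMeasure μ]
    (h : SymmetricLaw s B c μ) (hs : 1 ≤ s) : Integrable (fun y : ℂ => ‖y‖) μ := by
  have hm : MemLp (fun y : ℂ => y) (ENNReal.ofReal s) μ := by
    refine ⟨aestronglyMeasurable_id, ?_⟩
    rw [eLpNorm_lt_top_iff_lintegral_rpow_enorm_lt_top (by simp; linarith) (by simp),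
      ENNReal.toReal_ofReal (by linarith)]
    exact h.moment_le.trans_lt ENNReal.ofReal_lt_top
  exact (hm.integrable (by rw [ENNReal.one_le_ofReal]; exact hs)).norm

/-- In a space of finite cotype, the moments of `∑ᵢ yᵢ xᵢ` for independent symmetric `yᵢ` depend
on the law of the `yᵢ` only up to a constant. -/
theorem exists_linear_domination {q₀ s p B c : ℝ} (hX : HasCotype X q₀) (hqs : q₀ < s)
    (hp : 1 ≤ p) (hps : p < s) (hB : 0 < B) (hc : 0 < c) :
    ∃ K : ℝ≥0, ∀ (μ ν : Measure ℂ) [IsProbabilityMeasure μ] [IsProbabilityMeasure ν],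
      SymmetricLaw s B c μ → SymmetricLaw s B c ν →
      ∀ (κ : Type) [Fintype κ] (x : κ → X),
        ∫⁻ y, ‖∑ i, y i • x i‖ₑ ^ p ∂Measure.pi (fun _ : κ => μ) ≤
          K * ∫⁻ y, ‖∑ i, y i • x i‖ₑ ^ p ∂Measure.pi (fun _ : κ => ν) := by
  -- Raising the cotype exponent to at least `p` keeps it below `s`, and `L^q` then controls `L^p`.
  set q := max q₀ p with hq
  have hpq : p ≤ q := le_max_right _ _
  have hq1 : 1 ≤ q := hp.trans hpq
  have hq0 : 0 < q := by linarith
  have hp0 : 0 < p := by linarith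
  obtain ⟨C, hC1, hC⟩ := hX.exists_sum_le (le_max_left q₀ p)
  obtain ⟨K₁, hK₁, h₁⟩ := exists_lintegral_radMoment_le hq1 hC1 hC (max_lt hqs hps) hB
  obtain ⟨K₂, hK₂, h₂⟩ := exists_radMoment_le_radMoment_one X hq1
  refine ⟨Real.toNNReal ((K₁ * K₂) ^ (p / q) * (2 / c) ^ p),
    fun μ ν _ _ hμ hν κ _ x => ?_⟩
  classical
  rw [lintegral_enorm_sum_rpow hμ.neg hp0.le, lintegral_enorm_sum_rpow hν.neg hp0.le]
  have hmeas : Measurable fun y : κ → ℂ => ENNReal.ofReal (radMoment q fun i => y i • x i) := by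
    have : Continuous fun y : κ → ℂ => radMoment q fun i => y i • x i :=
      (continuous_radMoment hq0.le).comp (by fun_prop)
    exact ENNReal.measurable_ofReal.comp this.measurable
  have n1 := radMoment_nonneg 1 x
  have nq := radMoment_nonneg q x
  have hc' : c ≤ ∫ y, ‖y‖ ∂ν := by
    have h := hν.le_moment
    have hi := hν.integrable (by linarith)
    have e : ∫⁻ y, ‖y‖ₑ ∂ν = ENNReal.ofReal (∫ y, ‖y‖ ∂ν) := by
      rw [ofReal_integral_eq_lintegral_ofReal hi (Filter.Eventually.of_forall fun y => norm_nonneg y)]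
      simp
    rw [e] at h
    exact (ENNReal.ofReal_le_ofReal_iff (integral_nonneg fun y => norm_nonneg y)).1 h
  calc ∫⁻ y, ENNReal.ofReal (radMoment p fun i => y i • x i) ∂Measure.pi (fun _ : κ => μ)
      ≤ ∫⁻ y, ENNReal.ofReal (radMoment q fun i => y i • x i) ^ (p / q)
          ∂Measure.pi (fun _ : κ => μ) := by
        refine lintegral_mono fun y => ?_
        rw [ENNReal.ofReal_rpow_of_nonneg (radMoment_nonneg _ _) (by positivity)]
        exact ENNReal.ofReal_le_ofReal (radMoment_rpow_le _ hp0 hpq)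
    _ ≤ (∫⁻ y, ENNReal.ofReal (radMoment q fun i => y i • x i)
          ∂Measure.pi (fun _ : κ => μ)) ^ (p / q) :=
        lintegral_rpow_le_rpow_lintegral _ hmeas.aemeasurable (by positivity)
          ((div_le_one hq0).2 hpq)
    _ ≤ ENNReal.ofReal (K₁ * radMoment q x) ^ (p / q) :=
        ENNReal.rpow_le_rpow (h₁ μ hμ.moment_le κ x) (by positivity)
    _ ≤ ENNReal.ofReal ((K₁ * K₂) ^ (p / q) * radMoment p x) := by
        rw [ENNReal.ofReal_rpow_of_nonneg (by positivity) (by positivity)]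
        refine ENNReal.ofReal_le_ofReal ?_
        calc (K₁ * radMoment q x) ^ (p / q) ≤ (K₁ * (K₂ * radMoment 1 x ^ q)) ^ (p / q) := by
              gcongr; exact h₂ κ x
          _ = (K₁ * K₂) ^ (p / q) * radMoment 1 x ^ p := by
              rw [← mul_assoc, Real.mul_rpow (by positivity) (by positivity), ← Real.rpow_mul n1,
                mul_div_cancel₀ _ hq0.ne']
          _ ≤ _ := by gcongr; exact radMoment_one_rpow_le x hp
    _ ≤ _ := by
        rw [ENNReal.ofReal_mul (by positivity), ← ENNReal.ofReal.eq_1,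
          ENNReal.ofReal_mul (by positivity), mul_assoc]
        gcongr
        exact ofReal_radMoment_le_lintegral hp hc ν (hν.integrable (by linarith)) hc' x

/-! ### Normalized sums -/

theorem expect_norm_add_radSum_sq {E : Type*} [NormedAddCommGroup E] [InnerProductSpace ℝ E]
    {n : ℕ} (x₀ : E) (x : Fin n → E) :
    𝔼 ε : Fin n → ℤˣ, ‖x₀ + radSum x ε‖ ^ 2 = ‖x₀‖ ^ 2 + ∑ i, ‖x i‖ ^ 2 := by
  induction n generalizing x₀ with
  | zero => simp [radSum]
  | succ n ih =>
    have hr : ∀ (u : ℤˣ) (ε : Fin n → ℤˣ), radSum x (Fin.cons u ε : Fin (n + 1) → ℤˣ) =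
        (u : ℤ) • x 0 + radSum (fun i => x i.succ) ε := by
      intro u ε
      simp [radSum, Fin.sum_univ_succ]
    rw [expect_fin_succ, ← Finset.expect_div, Finset.expect_add_distrib]
    simp only [hr, ← add_assoc, ih, Fin.sum_univ_succ]
    simp only [Units.val_one, Units.val_neg, one_smul, neg_smul, ← sub_eq_add_neg]
    have := parallelogram_law_with_norm ℝ x₀ (x 0)
    simp only [sq] at *
    linarith

theorem radMoment_two_eq {E : Type*} [NormedAddCommGroup E] [InnerProductSpace ℝ E] {n : ℕ}
    (x : Fin n → E) : radMoment 2 x = ∑ i, ‖x i‖ ^ 2 := by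
  have := expect_norm_add_radSum_sq 0 x
  simp only [zero_add, norm_zero] at this
  unfold radMoment
  simp only [Real.rpow_two]
  rw [this]
  simp

/-- The normalized sum `m^{-1/2} ∑ₗ wₗ`. -/
noncomputable def normalizedSum (m : ℕ) (w : Fin m → ℂ) : ℂ := ((√m : ℝ) : ℂ)⁻¹ * ∑ l, w l

/-- The law of the normalized sum of `m` independent copies. -/
noncomputable def normalizedSumLaw (m : ℕ) (μ : Measure ℂ) : Measure ℂ :=
  (Measure.pi fun _ : Fin m => μ).map (normalizedSum m)

theorem measurable_normalizedSum (m : ℕ) : Measurable (normalizedSum m) := by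
  unfold normalizedSum; fun_prop

instance (m : ℕ) (μ : Measure ℂ) [IsProbabilityMeasure μ] :
    IsProbabilityMeasure (normalizedSumLaw m μ) :=
  Measure.isProbabilityMeasure_map (measurable_normalizedSum m).aemeasurable

theorem lintegral_normalizedSumLaw {m : ℕ} {μ : Measure ℂ} [IsProbabilityMeasure μ]
    (hμ : MeasurePreserving (fun y => -y) μ μ) {p : ℝ} (hp : 0 ≤ p) :
    ∫⁻ y, ‖y‖ₑ ^ p ∂normalizedSumLaw m μ = ∫⁻ w : Fin m → ℂ,
      ENNReal.ofReal (radMoment p fun l => w l • ((√m : ℝ) : ℂ)⁻¹) ∂Measure.pi fun _ => μ := by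
  unfold normalizedSumLaw
  rw [lintegral_map (by fun_prop) (measurable_normalizedSum m), ← lintegral_enorm_sum_rpow hμ hp]
  refine lintegral_congr fun w => ?_
  rw [normalizedSum, mul_comm, Finset.sum_mul]
  rfl

theorem radMoment_two_normalized {m : ℕ} (w : Fin m → ℂ) :
    radMoment 2 (fun l => w l • ((√m : ℝ) : ℂ)⁻¹) = ∑ l, (m : ℝ)⁻¹ * ‖w l‖ ^ 2 := by
  rw [radMoment_two_eq]
  refine Finset.sum_congr rfl fun l _ => ?_
  rw [norm_smul, norm_inv, Complex.norm_real, Real.norm_of_nonneg (Real.sqrt_nonneg _), mul_pow,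
    inv_pow, Real.sq_sqrt m.cast_nonneg, mul_comm]

/-- Scalar Khintchine compares all moments of the normalized sum with the quadratic mean of the `‖w
l‖`. Since `s ≥ 2`, this mean is at most the `s`-mean and at least the arithmetic mean, so the
bounds do not depend on `m`. The law `μ` is included so that both laws share the same constants. -/
theorem exists_symmetricLaw_normalizedSum {s B c : ℝ} (hs : 2 ≤ s) (hB : 0 < B) (hc : 0 < c) :
    ∃ B' c' : ℝ, 0 < B' ∧ 0 < c' ∧ ∀ (μ : Measure ℂ) [IsProbabilityMeasure μ],
      SymmetricLaw s B c μ → SymmetricLaw s B' c' μ ∧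
        ∀ m : ℕ, m ≠ 0 → SymmetricLaw s B' c' (normalizedSumLaw m μ) := by
  have hs0 : 0 < s := by linarith
  obtain ⟨K, hK, h⟩ := exists_radMoment_le_radMoment_one ℂ (q := s) (by linarith)
  have hK1 : 1 ≤ max K 1 := le_max_right _ _
  refine ⟨max K 1 ^ s⁻¹ * B, c / 4, by positivity, by positivity, fun μ _ hμ => ?_⟩
  have hBs : (max K 1 ^ s⁻¹ * B) ^ s = max K 1 * B ^ s := by
    rw [Real.mul_rpow (by positivity) hB.le, ← Real.rpow_mul (by positivity),
      inv_mul_cancel₀ hs0.ne', Real.rpow_one]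
  refine ⟨⟨hμ.neg, ?_, ?_⟩, fun m hm => ⟨?_, ?_, ?_⟩⟩
  · rw [hBs]
    refine hμ.moment_le.trans (ENNReal.ofReal_le_ofReal ?_)
    exact le_mul_of_one_le_left (by positivity) hK1
  · exact (ENNReal.ofReal_le_ofReal (by linarith)).trans hμ.le_moment
  · refine ⟨measurable_neg, ?_⟩
    unfold normalizedSumLaw
    rw [Measure.map_map measurable_neg (measurable_normalizedSum m)]
    have h1 := (measurePreserving_pi_zsmul (κ := Fin m) hμ.neg (fun _ => -1)).map_eq
    conv_rhs => rw [← h1, Measure.map_map (measurable_normalizedSum m)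
      (measurePreserving_pi_zsmul (κ := Fin m) hμ.neg (fun _ => -1)).measurable]
    congr 1
    ext w
    simp [normalizedSum]
  · rw [lintegral_normalizedSumLaw hμ.neg hs0.le, hBs]
    have hm0 : (0 : ℝ) < m := by positivity
    have bound : ∀ w : Fin m → ℂ, radMoment s (fun l => w l • ((√m : ℝ) : ℂ)⁻¹) ≤
        max K 1 * ∑ l, (m : ℝ)⁻¹ * ‖w l‖ ^ s := by
      intro w
      set a : Fin m → ℂ := fun l => w l • ((√m : ℝ) : ℂ)⁻¹ with ha
      have n1 := radMoment_nonneg 1 a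
      have n2 := radMoment_nonneg 2 a
      calc radMoment s a ≤ max K 1 * radMoment 1 a ^ s :=
            (h (Fin m) a).trans (by gcongr; exact le_max_left _ _)
        _ ≤ max K 1 * (radMoment 2 a ^ (1 / 2 : ℝ)) ^ s := by
            gcongr
            exact radMoment_rpow_le a one_pos one_le_two
        _ = max K 1 * (∑ l, (m : ℝ)⁻¹ * ‖w l‖ ^ 2) ^ (s / 2) := by
            rw [← Real.rpow_mul n2, ha, radMoment_two_normalized]
            congr 2; ring
        _ ≤ max K 1 * ∑ l, (m : ℝ)⁻¹ * (‖w l‖ ^ 2) ^ (s / 2) := by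
            gcongr
            exact rpow_sum_mul_le _ _ _ (fun _ => by positivity) (fun _ => by positivity)
              (by simp [hm0.ne']) (by linarith)
        _ = _ := by
            congr 1
            refine Finset.sum_congr rfl fun l _ => ?_
            rw [← Real.rpow_natCast, ← Real.rpow_mul (norm_nonneg _)]
            congr 2; push_cast; ring
    calc _ ≤ ∫⁻ w : Fin m → ℂ, ENNReal.ofReal (max K 1) * ∑ l, (m : ℝ≥0∞)⁻¹ * ‖w l‖ₑ ^ s
          ∂Measure.pi fun _ => μ := by
          refine lintegral_mono fun w => (ENNReal.ofReal_le_ofReal (bound w)).trans (le_of_eq ?_)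
          rw [ENNReal.ofReal_mul (by positivity),
            ENNReal.ofReal_sum_of_nonneg fun l _ => by positivity]
          congr 1
          refine Finset.sum_congr rfl fun l _ => ?_
          rw [ENNReal.ofReal_mul (by positivity), ofReal_norm_rpow _ hs0.le,
            ENNReal.ofReal_inv_of_pos hm0, ENNReal.ofReal_natCast]
      _ = ENNReal.ofReal (max K 1) * ∫⁻ y, ‖y‖ₑ ^ s ∂μ := by
          rw [lintegral_const_mul _ (by fun_prop), lintegral_finsetSum _ (by fun_prop)]
          have : ∀ l : Fin m, ∫⁻ w : Fin m → ℂ, (m : ℝ≥0∞)⁻¹ * ‖w l‖ₑ ^ s ∂Measure.pi (fun _ => μ) =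
              (m : ℝ≥0∞)⁻¹ * ∫⁻ y, ‖y‖ₑ ^ s ∂μ := by
            intro l
            rw [lintegral_const_mul _ (by fun_prop)]
            congr 1
            exact (measurePreserving_eval (fun _ : Fin m => μ) l).lintegral_comp
              (f := fun y => ‖y‖ₑ ^ s) (by fun_prop)
          simp only [this, Finset.sum_const, Finset.card_univ, Fintype.card_fin, nsmul_eq_mul]
          rw [← mul_assoc (m : ℝ≥0∞), ENNReal.mul_inv_cancel (by simpa) (by simp), one_mul]
      _ ≤ _ := by
          rw [ENNReal.ofReal_mul (by positivity)]
          gcongr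
          exact hμ.moment_le
  · have hm0 : (0 : ℝ) < m := by positivity
    have e1 : ∫⁻ y, ‖y‖ₑ ∂normalizedSumLaw m μ = ∫⁻ y, ‖y‖ₑ ^ (1 : ℝ) ∂normalizedSumLaw m μ := by
      simp
    rw [e1, lintegral_normalizedSumLaw hμ.neg zero_le_one]
    have bound : ∀ w : Fin m → ℂ, (1 / 4 : ℝ) * ∑ l, (m : ℝ)⁻¹ * ‖w l‖ ≤
        radMoment 1 (fun l => w l • ((√m : ℝ) : ℂ)⁻¹) := by
      intro w
      have h2 := radMoment_two_le (fun l => w l • ((√m : ℝ) : ℂ)⁻¹)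
      rw [radMoment_two_normalized] at h2
      have n1 := radMoment_nonneg 1 (fun l => w l • ((√m : ℝ) : ℂ)⁻¹)
      have j := rpow_sum_mul_le Finset.univ (fun _ : Fin m => (m : ℝ)⁻¹) (fun l => ‖w l‖)
        (fun _ => by positivity) (fun _ => norm_nonneg _) (by simp [hm0.ne']) one_le_two
      simp only [Real.rpow_two] at j
      have := abs_le_of_sq_le_sq' ((j.trans h2).trans (by rw [mul_pow]; norm_num) :
        (∑ l, (m : ℝ)⁻¹ * ‖w l‖) ^ 2 ≤ (4 * radMoment 1 fun l => w l • ((√m : ℝ) : ℂ)⁻¹) ^ 2)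
        (by positivity)
      linarith [this.2]
    calc ENNReal.ofReal (c / 4) = ENNReal.ofReal (1 / 4) * ENNReal.ofReal c := by
          rw [← ENNReal.ofReal_mul (by norm_num)]; congr 1; ring
      _ ≤ ENNReal.ofReal (1 / 4) * ∫⁻ y, ‖y‖ₑ ∂μ := by gcongr; exact hμ.le_moment
      _ = ∫⁻ w : Fin m → ℂ, ENNReal.ofReal (1 / 4) * ∑ l, (m : ℝ≥0∞)⁻¹ * ‖w l‖ₑ
          ∂Measure.pi fun _ => μ := by
          rw [lintegral_const_mul _ (by fun_prop), lintegral_finsetSum _ (by fun_prop)]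
          have : ∀ l : Fin m, ∫⁻ w : Fin m → ℂ, (m : ℝ≥0∞)⁻¹ * ‖w l‖ₑ ∂Measure.pi (fun _ => μ) =
              (m : ℝ≥0∞)⁻¹ * ∫⁻ y, ‖y‖ₑ ∂μ := by
            intro l
            rw [lintegral_const_mul _ (by fun_prop)]
            congr 1
            exact (measurePreserving_eval (fun _ : Fin m => μ) l).lintegral_comp
              (f := fun y => ‖y‖ₑ) (by fun_prop)
          simp only [this, Finset.sum_const, Finset.card_univ, Fintype.card_fin, nsmul_eq_mul]
          rw [← mul_assoc (m : ℝ≥0∞), ENNReal.mul_inv_cancel (by simpa) (by simp), one_mul]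
      _ ≤ _ := by
          refine lintegral_mono fun w => le_trans (le_of_eq ?_) (ENNReal.ofReal_le_ofReal (bound w))
          rw [ENNReal.ofReal_mul (by positivity),
            ENNReal.ofReal_sum_of_nonneg fun l _ => by positivity]
          congr 1
          refine Finset.sum_congr rfl fun l _ => ?_
          rw [ENNReal.ofReal_mul (by positivity), ofReal_norm, ENNReal.ofReal_inv_of_pos hm0,
            ENNReal.ofReal_natCast]

end Domination

/-! ### Tetrahedral polynomials and their associated multilinear operators -/

section Tetrahedral

theorem sum_prod_apply {K S R : Type*} [Fintype K] [DecidableEq K] [Fintype S]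
    [CommSemiring R] (h : K → S → R) : ∑ c : K → S, ∏ k, h k (c k) = ∏ k, ∑ t, h k t := by
  rw [Finset.prod_univ_sum, Fintype.piFinset_univ]

/-- Injectivity makes the factors depend on different coordinates of `c`, hence independent;
coordinates outside the range of `f` average to `1`. -/
theorem expect_prod_comp_injective {L K S : Type*} [Fintype L] [Fintype K] [DecidableEq K]
    [Fintype S] [Nonempty S] {f : L → K} (hf : f.Injective) (g : L → S → ℂ) :
    (Fintype.card (K → S) : ℂ)⁻¹ * ∑ c : K → S, ∏ l, g l (c (f l)) =
      ∏ l, (Fintype.card S : ℂ)⁻¹ * ∑ t, g l t := by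
  classical
  have hS : (Fintype.card S : ℂ) ≠ 0 := by simp
  have e1 : ∀ c : K → S, ∏ l, g l (c (f l)) = ∏ k, ∏ l with f l = k, g l (c k) := by
    intro c
    rw [← Finset.prod_fiberwise Finset.univ f]
    refine Finset.prod_congr rfl fun k _ => Finset.prod_congr rfl fun l hl => ?_
    rw [(Finset.mem_filter.1 hl).2]
  have e2 : ∀ k, (Fintype.card S : ℂ)⁻¹ * ∑ t, ∏ l with f l = k, g l t =
      ∏ l with f l = k, (Fintype.card S : ℂ)⁻¹ * ∑ t, g l t := by
    intro k
    by_cases hk : ∃ l, f l = k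
    · obtain ⟨l, rfl⟩ := hk
      have : Finset.univ.filter (fun l' => f l' = f l) = {l} := by
        ext l'; simp [hf.eq_iff]
      rw [this]
      simp
    · have : Finset.univ.filter (fun l => f l = k) = ∅ := by
        ext l; simpa using fun h => hk ⟨l, h⟩
      rw [this]
      simp [hS]
  simp only [e1]
  rw [sum_prod_apply (fun k t => ∏ l with f l = k, g l t),
    ← Finset.prod_fiberwise Finset.univ f (fun l => (Fintype.card S : ℂ)⁻¹ * ∑ t, g l t)]
  simp only [← e2, Finset.prod_mul_distrib, Finset.prod_const, Finset.card_univ]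
  simp [Fintype.card_pi]

variable {X : Type*} [NormedAddCommGroup X] [NormedSpace ℂ X] {m n : ℕ}
  {M : MultilinearMap ℂ (fun _ : Fin m => Fin n → ℂ) X} {P : (Fin n → ℂ) → X}

theorem multilinear_expand (M : MultilinearMap ℂ (fun _ : Fin m => Fin n → ℂ) X)
    (z : Fin m → Fin n → ℂ) :
    M z = ∑ f : Fin m → Fin n, (∏ l, z l (f l)) • M fun l => Pi.single (f l) 1 := by
  have h : z = fun l => ∑ k, z l k • (Pi.single k 1 : Fin n → ℂ) := by
    ext l j
    simp [Pi.single_apply]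
  conv_lhs => rw [h]
  rw [M.map_sum]
  exact Finset.sum_congr rfl fun f _ => M.map_smul_univ _ _

theorem continuous_multilinear (M : MultilinearMap ℂ (fun _ : Fin m => Fin n → ℂ) X) :
    Continuous M := by
  have : (M : (Fin m → Fin n → ℂ) → X) = fun z => ∑ f : Fin m → Fin n,
      (∏ l, z l (f l)) • M fun l => Pi.single (f l) 1 := funext (multilinear_expand M)
  rw [this]
  fun_prop

/-- If `f` misses `k`, the sign `r k` occurs exactly once in the product, and its sum vanishes. -/
theorem sum_sign_prod_of_not_surjective {f : Fin m → Fin m} (hf : ¬ f.Surjective) :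
    ∑ r : Fin m → ℤˣ, (∏ l, ((r l : ℤ) : ℂ)) * ∏ j, ((r (f j) : ℤ) : ℂ) = 0 := by
  simp only [Function.Surjective, not_forall, not_exists] at hf
  obtain ⟨k, hk⟩ := hf
  have e : ∀ r : Fin m → ℤˣ, (∏ l, ((r l : ℤ) : ℂ)) * ∏ j, ((r (f j) : ℤ) : ℂ) =
      ∏ l, (((r l : ℤ) : ℂ) * ∏ j with f j = l, ((r l : ℤ) : ℂ)) := by
    intro r
    rw [Finset.prod_mul_distrib, ← Finset.prod_fiberwise Finset.univ f fun j => ((r (f j) : ℤ) : ℂ)]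
    congr 1
    refine Finset.prod_congr rfl fun l _ => Finset.prod_congr rfl fun j hj => ?_
    rw [(Finset.mem_filter.1 hj).2]
  simp only [e]
  rw [sum_prod_apply (fun l (u : ℤˣ) => ((u : ℤ) : ℂ) * ∏ j with f j = l, ((u : ℤ) : ℂ))]
  refine Finset.prod_eq_zero (Finset.mem_univ k) ?_
  have : Finset.univ.filter (fun j => f j = k) = ∅ := by
    ext j; simpa using hk j
  rw [this]
  have hu : (Finset.univ : Finset ℤˣ) = {1, -1} := by decide
  rw [hu, Finset.sum_pair (by decide)]
  simp

theorem sum_sign_prod_of_bijective {f : Fin m → Fin m} (hf : f.Bijective) :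
    ∑ r : Fin m → ℤˣ, (∏ l, ((r l : ℤ) : ℂ)) * ∏ j, ((r (f j) : ℤ) : ℂ) = 2 ^ m := by
  have : ∀ r : Fin m → ℤˣ, (∏ l, ((r l : ℤ) : ℂ)) * ∏ j, ((r (f j) : ℤ) : ℂ) = 1 := by
    intro r
    rw [Function.Bijective.prod_comp hf (fun l => ((r l : ℤ) : ℂ)), ← Finset.prod_mul_distrib]
    refine Finset.prod_eq_one fun l _ => ?_
    rcases Int.units_eq_one_or (r l) with h | h <;> simp [h]
  simp [this]

/-- The polarization formula. -/
theorem polarization (h : IsAssociatedSymmetric M P) (z : Fin m → Fin n → ℂ) :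
    ((2 : ℂ) ^ m)⁻¹ • ∑ r : Fin m → ℤˣ, (∏ l, ((r l : ℤ) : ℂ)) • P (∑ l, ((r l : ℤ) : ℂ) • z l) =
      (m.factorial : ℂ) • M z := by
  have expand : ∀ r : Fin m → ℤˣ, P (∑ l, ((r l : ℤ) : ℂ) • z l) =
      ∑ f : Fin m → Fin m, (∏ j, ((r (f j) : ℤ) : ℂ)) • M fun j => z (f j) := by
    intro r
    rw [← h.2, M.map_sum fun _ l => ((r l : ℤ) : ℂ) • z l]
    exact Finset.sum_congr rfl fun f _ => M.map_smul_univ _ _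
  simp only [expand, Finset.smul_sum (r := ∏ l, _), smul_smul]
  rw [Finset.sum_comm]
  simp only [← Finset.sum_smul]
  have hsum : ∑ f : Fin m → Fin m, (∑ r : Fin m → ℤˣ, (∏ l, ((r l : ℤ) : ℂ)) *
      ∏ j, ((r (f j) : ℤ) : ℂ)) • (M fun j => z (f j)) =
      ∑ f : Fin m → Fin m with f.Bijective, (2 : ℂ) ^ m • M z := by
    rw [Finset.sum_filter]
    refine Finset.sum_congr rfl fun f _ => ?_
    split_ifs with hf
    · rw [sum_sign_prod_of_bijective hf, ← h.1 (Equiv.ofBijective f hf) z]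
      rfl
    · rw [sum_sign_prod_of_not_surjective (fun hs => hf (Finite.surjective_iff_bijective.1 hs)),
        zero_smul]
  rw [hsum, Finset.sum_const, ← Nat.cast_smul_eq_nsmul ℂ, smul_comm, smul_smul ((2 : ℂ) ^ m)⁻¹,
    inv_mul_cancel₀ (by simp), one_smul]
  congr 2
  rw [← Fintype.card_fin m, ← Fintype.card_perm, Fintype.card_fin]
  rw [← Fintype.card_subtype]
  exact Fintype.card_congr (Equiv.ofBijective
    (fun f : {f : Fin m → Fin m // f.Bijective} => Equiv.ofBijective f.1 f.2)
    ⟨fun f g hfg => Subtype.ext (by simpa [Equiv.ext_iff, funext_iff] using hfg),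
      fun σ => ⟨⟨σ, σ.bijective⟩, by ext; rfl⟩⟩)

/-- By polarization the value is a combination of values of `P` at vectors supported on fewer than
`m` coordinates, where every monomial with `m` distinct variables vanishes. -/
theorem multilinear_single_eq_zero (hP : IsTetrahedralHomogeneous m P)
    (h : IsAssociatedSymmetric M P) {f : Fin m → Fin n} (hf : ¬ f.Injective) :
    M (fun l => Pi.single (f l) 1) = 0 := by
  obtain ⟨x, hx⟩ := hP
  have hzero : ∀ a : Fin m → ℂ, P (∑ l, a l • Pi.single (f l) 1) = 0 := by
    intro a
    rw [hx]
    refine Finset.sum_eq_zero fun A hA => ?_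
    have hcard : (Finset.univ.image f).card < A.card := by
      rw [(Finset.mem_powersetCard.1 hA).2]
      refine lt_of_le_of_ne (Finset.card_image_le.trans (by simp)) fun he => hf ?_
      have hi : Set.InjOn f (Finset.univ : Finset (Fin m)) :=
        Finset.card_image_iff.1 (by simpa using he)
      exact fun a b hab => hi (by simp) (by simp) hab
    obtain ⟨k, hkA, hk⟩ := Finset.exists_mem_notMem_of_card_lt_card hcard
    rw [Finset.prod_eq_zero hkA, zero_smul]
    rw [Finset.sum_apply]
    refine Finset.sum_eq_zero fun l _ => ?_
    have : k ≠ f l := fun e => hk (Finset.mem_image.2 ⟨l, Finset.mem_univ _, e.symm⟩)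
    simp [this]
  have hp := polarization h fun l => (Pi.single (f l) 1 : Fin n → ℂ)
  simp only [hzero, smul_zero, Finset.sum_const_zero] at hp
  exact (smul_eq_zero.1 hp.symm).resolve_left (by exact_mod_cast m.factorial_ne_zero)

/-- Averaging the blocks of coordinates independently. -/
theorem multilinear_average (hP : IsTetrahedralHomogeneous m P) (h : IsAssociatedSymmetric M P)
    {S : Type*} [Fintype S] [Nonempty S] (w : Fin n → S → Fin m → ℂ) (v : Fin n → ℂ)
    (hv : ∀ i l, (Fintype.card S : ℂ)⁻¹ * ∑ t, w i t l = v i) :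
    (Fintype.card (Fin n → S) : ℂ)⁻¹ • ∑ c : Fin n → S, M (fun l i => w i (c i) l) = P v := by
  rw [← h.2]
  simp only [multilinear_expand M (fun l i => w i _ l)]
  rw [multilinear_expand M, Finset.sum_comm, Finset.smul_sum]
  refine Finset.sum_congr rfl fun f _ => ?_
  by_cases hf : f.Injective
  · rw [← Finset.sum_smul, smul_smul,
      expect_prod_comp_injective hf fun l t => w (f l) t l]
    simp only [hv]
  · simp [multilinear_single_eq_zero hP h hf]

end Tetrahedral

/-! ### Comparison of tetrahedral polynomials in different random variables -/

section Comparison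

variable {X : Type*} [NormedAddCommGroup X] [NormedSpace ℂ X]

theorem enorm_rpow_average_le {J : Type*} [Fintype J] [Nonempty J] {p : ℝ} (hp : 1 ≤ p)
    (v : J → X) : ‖(Fintype.card J : ℂ)⁻¹ • ∑ j, v j‖ₑ ^ p ≤
      (Fintype.card J : ℝ≥0∞)⁻¹ * ∑ j, ‖v j‖ₑ ^ p := by
  let _ : NormedSpace ℝ X := NormedSpace.complexToReal
  have hJ : (0 : ℝ) < Fintype.card J := by exact_mod_cast Fintype.card_pos
  have h := norm_rpow_sum_smul_le Finset.univ (fun _ : J => (Fintype.card J : ℝ)⁻¹) v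
    (fun _ => by positivity) (by simp) hp
  rw [← Finset.smul_sum, ← Finset.mul_sum, ← Complex.coe_smul] at h
  rw [← ofReal_norm_rpow _ (by linarith)]
  refine (ENNReal.ofReal_le_ofReal (le_trans (le_of_eq ?_) h)).trans (le_of_eq ?_)
  · push_cast; rfl
  · rw [ENNReal.ofReal_mul (by positivity), ENNReal.ofReal_sum_of_nonneg fun _ _ => by positivity,
      ENNReal.ofReal_inv_of_pos hJ, ENNReal.ofReal_natCast]
    simp only [ofReal_norm_rpow _ (show 0 ≤ p by linarith)]

theorem lintegral_average_le {J α : Type*} [Fintype J] [Nonempty J] [MeasurableSpace α]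
    (μ : Measure α) {p : ℝ} (hp : 1 ≤ p) (V : J → α → X)
    (hV : ∀ j, Measurable fun a => ‖V j a‖ₑ) {A : ℝ≥0∞}
    (hA : ∀ j, ∫⁻ a, ‖V j a‖ₑ ^ p ∂μ ≤ A) :
    ∫⁻ a, ‖(Fintype.card J : ℂ)⁻¹ • ∑ j, V j a‖ₑ ^ p ∂μ ≤ A := by
  refine (lintegral_mono fun a => enorm_rpow_average_le hp fun j => V j a).trans ?_
  have hm : ∀ j, Measurable fun a => ‖V j a‖ₑ ^ p := fun j => (hV j).pow_const p
  rw [lintegral_const_mul _ (Finset.measurable_sum _ fun j _ => hm j),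
    lintegral_finsetSum _ fun j _ => hm j]
  calc (Fintype.card J : ℝ≥0∞)⁻¹ * ∑ j, ∫⁻ a, ‖V j a‖ₑ ^ p ∂μ
      ≤ (Fintype.card J : ℝ≥0∞)⁻¹ * ∑ _j : J, A := by gcongr with j; exact hA j
    _ = A := by
      rw [Finset.sum_const, nsmul_eq_mul, Finset.card_univ, ← mul_assoc,
        ENNReal.inv_mul_cancel (by simp) (by simp), one_mul]

variable {m n : ℕ} {M : MultilinearMap ℂ (fun _ : Fin m => Fin n → ℂ) X} {P : (Fin n → ℂ) → X}

theorem IsAssociatedSymmetric.continuous (h : IsAssociatedSymmetric M P) : Continuous P := by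
  have : P = fun z => M fun _ => z := funext fun z => (h.2 z).symm
  rw [this]
  exact (continuous_multilinear M).comp (by fun_prop)

theorem IsAssociatedSymmetric.map_smul (h : IsAssociatedSymmetric M P) (a : ℂ) (z : Fin n → ℂ) :
    P (a • z) = a ^ m • P z := by
  rw [← h.2, ← h.2, M.map_smul_univ (fun _ => a) fun _ => z]
  simp

/-- Polarization bounds the moments of `m! M` by those of `P` at signed sums. -/
theorem lintegral_factorial_smul_le {α : Type*} [MeasurableSpace α] (μ : Measure α)
    (h : IsAssociatedSymmetric M P) {p : ℝ} (hp : 1 ≤ p) (Z : α → Fin m → Fin n → ℂ)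
    (hZ : Measurable Z) {A : ℝ≥0∞}
    (hA : ∀ r : Fin m → ℤˣ, ∫⁻ a, ‖P (∑ l, ((r l : ℤ) : ℂ) • Z a l)‖ₑ ^ p ∂μ ≤ A) :
    ∫⁻ a, ‖(m.factorial : ℂ) • M (Z a)‖ₑ ^ p ∂μ ≤ A := by
  have hsign : ∀ r : Fin m → ℤˣ, ‖∏ l, ((r l : ℤ) : ℂ)‖ₑ = 1 := by
    intro r
    rw [← ofReal_norm, norm_prod, Finset.prod_eq_one, ENNReal.ofReal_one]
    intro l _
    rcases Int.units_eq_one_or (r l) with h | h <;> simp [h]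
  have e : ∀ a, (m.factorial : ℂ) • M (Z a) = (Fintype.card (Fin m → ℤˣ) : ℂ)⁻¹ •
      ∑ r : Fin m → ℤˣ, (∏ l, ((r l : ℤ) : ℂ)) • P (∑ l, ((r l : ℤ) : ℂ) • Z a l) := by
    intro a
    rw [← polarization h]
    simp
  simp only [e]
  refine lintegral_average_le μ hp _ (fun r => ?_) fun r => ?_
  · simp only [enorm_smul, hsign, one_mul]
    have : Continuous fun z : Fin m → Fin n → ℂ => P (∑ l, ((r l : ℤ) : ℂ) • z l) :=
      h.continuous.comp (by fun_prop)
    exact this.enorm.measurable.comp hZ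
  · simpa only [enorm_smul, hsign, one_mul] using hA r

/-- The part of the vector `z` carried by the `l`-th class of the coloring `c`. -/
def classPart (c : Fin n → Fin m) (z : Fin n → ℂ) : Fin m → Fin n → ℂ :=
  fun l i => if c i = l then z i else 0

theorem measurable_classPart (c : Fin n → Fin m) : Measurable (classPart c) := by
  unfold classPart
  refine measurable_pi_lambda _ fun l => measurable_pi_lambda _ fun i => ?_
  split_ifs <;> fun_prop

/-- The signed sum of the class parts of `z` is `z` with sign `r (c i)` at coordinate `i`, which has
the same law. -/
theorem lintegral_factorial_classPart_le {μ : Measure ℂ} [IsProbabilityMeasure μ]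
    (hμ : MeasurePreserving (fun y => -y) μ μ) (h : IsAssociatedSymmetric M P) {p : ℝ}
    (hp : 1 ≤ p) (c : Fin n → Fin m) :
    ∫⁻ z, ‖(m.factorial : ℂ) • M (classPart c z)‖ₑ ^ p ∂Measure.pi (fun _ => μ) ≤
      ∫⁻ z, ‖P z‖ₑ ^ p ∂Measure.pi (fun _ => μ) := by
  refine lintegral_factorial_smul_le _ h hp _ (measurable_classPart c) fun r => le_of_eq ?_
  rw [← (measurePreserving_pi_zsmul hμ fun i => r (c i)).lintegral_comp
    (f := fun z => ‖P z‖ₑ ^ p) (h.continuous.enorm.measurable.pow_const p)]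
  refine lintegral_congr fun z => ?_
  congr 3
  ext i
  simp [classPart, Finset.sum_apply]

/-- With the other classes frozen, the expression is a linear sum in the coordinates of class `l`,
so `hK` changes the law there. There are `m` classes. -/
theorem lintegral_classPart_le {μ ν : Measure ℂ} [IsProbabilityMeasure μ] [IsProbabilityMeasure ν]
    {p : ℝ} {K : ℝ≥0∞}
    (hK : ∀ (κ : Type) [Fintype κ] (x : κ → X),
      ∫⁻ y, ‖∑ i, y i • x i‖ₑ ^ p ∂Measure.pi (fun _ : κ => μ) ≤
        K * ∫⁻ y, ‖∑ i, y i • x i‖ₑ ^ p ∂Measure.pi (fun _ : κ => ν))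
    (M : MultilinearMap ℂ (fun _ : Fin m => Fin n → ℂ) X) (c : Fin n → Fin m) :
    ∫⁻ z, ‖M (classPart c z)‖ₑ ^ p ∂Measure.pi (fun _ => μ) ≤
      K ^ m * ∫⁻ z, ‖M (classPart c z)‖ₑ ^ p ∂Measure.pi (fun _ => ν) := by
  have hf : Measurable fun z => ‖M (classPart c z)‖ₑ ^ p :=
    ((continuous_multilinear M).enorm.measurable.comp (measurable_classPart c)).pow_const p
  refine (lintegral_pi_le_of_fibers (Y := fun _ => ℂ) c (fun _ => μ) (fun _ => ν) hf (K := K)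
    fun l z => ?_).trans (by rw [Fintype.card_fin])
  set s : Finset (Fin n) := Finset.univ.filter fun i => c i = l with hs
  let x : s → X := fun i => M (Function.update (classPart c z) l (Pi.single (i : Fin n) 1))
  have key : ∀ y : s → ℂ, M (classPart c (Function.updateFinset z s y)) = ∑ i, y i • x i := by
    intro y
    have e : classPart c (Function.updateFinset z s y) = Function.update (classPart c z) l
        (∑ i : s, y i • (Pi.single (i : Fin n) 1 : Fin n → ℂ)) := by
      ext l' i
      by_cases hl : l' = l
      · subst hl
        rw [Function.update_self, Finset.sum_apply]
        by_cases hi : c i = l'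
        · have his : i ∈ s := by simp [hs, hi]
          rw [Finset.sum_eq_single ⟨i, his⟩]
          · simp [classPart, hi, Function.updateFinset, his]
          · intro j _ hj
            have : i ≠ j := fun e => hj (Subtype.ext e.symm)
            simp [this]
          · simp
        · rw [Finset.sum_eq_zero]
          · simp [classPart, hi]
          · intro j _
            have : i ≠ j := fun e => hi (e ▸ (Finset.mem_filter.1 j.2).2)
            simp [this]
      · rw [Function.update_of_ne hl]
        simp only [classPart]
        split_ifs with hi
        · have his : i ∉ s := by simp [hs, hi, hl]
          simp [Function.updateFinset, his]
        · rfl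
    rw [e, M.map_update_sum]
    exact Finset.sum_congr rfl fun i _ => M.map_update_smul _ _ _ _
  simp only [lmarginal, key]
  exact hK s x

/-- The indicator of `c i = l` multiplied by `m` has mean `1`; the `m` slots together give `m ^ m`.
-/
theorem average_classPart (hP : IsTetrahedralHomogeneous m P) (h : IsAssociatedSymmetric M P)
    (hm : m ≠ 0) (z : Fin n → ℂ) :
    (Fintype.card (Fin n → Fin m) : ℂ)⁻¹ • ∑ c : Fin n → Fin m, (m : ℂ) ^ m • M (classPart c z) =
      P z := by
  have : NeZero m := ⟨hm⟩
  rw [← multilinear_average hP h (S := Fin m) (fun i t l => (m : ℂ) * if t = l then z i else 0) z]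
  · congr 1
    refine Finset.sum_congr rfl fun c _ => ?_
    have := M.map_smul_univ (fun _ => (m : ℂ)) (classPart c z)
    simp only [Finset.prod_const, Finset.card_univ, Fintype.card_fin] at this
    rw [← this]
    rfl
  · intro i l
    rw [← Finset.mul_sum, Fintype.card_fin, inv_mul_cancel_left₀ (by exact_mod_cast hm)]
    simp

/-- Linear domination of symmetric laws extends to tetrahedral polynomials. -/
theorem lintegral_polynomial_le {μ ν : Measure ℂ} [IsProbabilityMeasure μ]
    [IsProbabilityMeasure ν] (hν : MeasurePreserving (fun y => -y) ν ν) {p : ℝ} (hp : 1 ≤ p)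
    {K : ℝ≥0∞}
    (hK : ∀ (κ : Type) [Fintype κ] (x : κ → X),
      ∫⁻ y, ‖∑ i, y i • x i‖ₑ ^ p ∂Measure.pi (fun _ : κ => μ) ≤
        K * ∫⁻ y, ‖∑ i, y i • x i‖ₑ ^ p ∂Measure.pi (fun _ : κ => ν))
    (hP : IsTetrahedralHomogeneous m P) (h : IsAssociatedSymmetric M P) (hm : m ≠ 0) :
    ∫⁻ z, ‖P z‖ₑ ^ p ∂Measure.pi (fun _ => μ) ≤
      ENNReal.ofReal ((m : ℝ) ^ m / m.factorial) ^ p * K ^ m *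
        ∫⁻ z, ‖P z‖ₑ ^ p ∂Measure.pi (fun _ => ν) := by
  have : NeZero m := ⟨hm⟩
  have hp0 : 0 ≤ p := by linarith
  have hM : ∀ c : Fin n → Fin m, Measurable fun z => ‖M (classPart c z)‖ₑ := fun c =>
    (continuous_multilinear M).enorm.measurable.comp (measurable_classPart c)
  have hfac : (m.factorial : ℂ) ≠ 0 := by exact_mod_cast m.factorial_ne_zero
  -- Averaging produces `m ^ m`, polarization controls `m!`; their ratio is the price.
  have hb : ∀ v : X, ‖(m : ℂ) ^ m • v‖ₑ ^ p =
      ENNReal.ofReal ((m : ℝ) ^ m / m.factorial) ^ p * ‖(m.factorial : ℂ) • v‖ₑ ^ p := by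
    intro v
    rw [← ENNReal.mul_rpow_of_nonneg _ _ hp0]
    congr 1
    have : (m : ℂ) ^ m • v = ((m : ℂ) ^ m / m.factorial) • (m.factorial : ℂ) • v := by
      rw [smul_smul, div_mul_cancel₀ _ hfac]
    rw [this, enorm_smul]
    congr 1
    rw [← ofReal_norm]
    simp
  simp only [← average_classPart hP h hm]
  refine lintegral_average_le _ hp _ (fun c => ?_) fun c => ?_
  · simp only [enorm_smul]
    exact (hM c).const_mul _
  simp only [average_classPart hP h hm, hb]
  rw [lintegral_const_mul _ (by simp only [enorm_smul]; exact ((hM c).const_mul _).pow_const p),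
    mul_assoc]
  gcongr
  refine le_trans ?_ (mul_le_mul_right (lintegral_factorial_classPart_le hν h hp c) _)
  simp only [enorm_smul, ENNReal.mul_rpow_of_nonneg _ _ hp0]
  rw [lintegral_const_mul _ ((hM c).pow_const p), lintegral_const_mul _ ((hM c).pow_const p),
    mul_left_comm]
  gcongr
  exact lintegral_classPart_le hK M c

end Comparison

/-! ### Decoupling -/

section Decoupling

variable {X : Type*} [NormedAddCommGroup X] [NormedSpace ℂ X]
  {m n : ℕ} {M : MultilinearMap ℂ (fun _ : Fin m => Fin n → ℂ) X} {P : (Fin n → ℂ) → X}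

theorem lintegral_pi_normalizedSumLaw (μ : Measure ℂ) [IsProbabilityMeasure μ]
    {f : (Fin n → ℂ) → ℝ≥0∞} (hf : Measurable f) :
    ∫⁻ z, f z ∂Measure.pi (fun _ => normalizedSumLaw m μ) =
      ∫⁻ w : Fin n → Fin m → ℂ, f (fun i => normalizedSum m (w i))
        ∂Measure.pi fun _ => Measure.pi fun _ => μ := by
  have : ∀ _ : Fin n, SigmaFinite ((Measure.pi fun _ : Fin m => μ).map (normalizedSum m)) :=
    fun _ => inferInstanceAs (SigmaFinite (normalizedSumLaw m μ))
  have h := Measure.pi_map_pi (ι := Fin n) (μ := fun _ => Measure.pi fun _ : Fin m => μ)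
    (f := fun _ => normalizedSum m) (fun _ => (measurable_normalizedSum m).aemeasurable)
  unfold normalizedSumLaw
  rw [← h, lintegral_map hf]
  exact measurable_pi_lambda _ fun i => (measurable_normalizedSum m).comp (measurable_pi_apply i)

theorem enorm_sqrt_pow (m : ℕ) : ‖(((√m : ℝ) : ℂ)) ^ m‖ₑ = (m : ℝ≥0∞) ^ ((m : ℝ) / 2) := by
  rw [← ofReal_norm, norm_pow, Complex.norm_real, Real.norm_of_nonneg (Real.sqrt_nonneg _),
    Real.sqrt_eq_rpow, ← Real.rpow_mul_natCast m.cast_nonneg, ← ENNReal.ofReal_natCast,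
    ENNReal.ofReal_rpow_of_nonneg m.cast_nonneg (by positivity)]
  congr 2
  ring

/-- After polarization, symmetry removes the signs from the sum of the copies, which is `√m` times
the normalized sum; homogeneity turns `√m` into `m ^ (m / 2)`. -/
theorem lintegral_factorial_decoupled_le {μ : Measure ℂ} [IsProbabilityMeasure μ]
    (hμ : MeasurePreserving (fun y => -y) μ μ) (h : IsAssociatedSymmetric M P) (hm : m ≠ 0) {p : ℝ}
    (hp : 1 ≤ p) :
    ∫⁻ w : Fin n → Fin m → ℂ, ‖(m.factorial : ℂ) • M (fun l i => w i l)‖ₑ ^ p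
        ∂Measure.pi (fun _ => Measure.pi fun _ => μ) ≤
      ((m : ℝ≥0∞) ^ ((m : ℝ) / 2)) ^ p *
        ∫⁻ z, ‖P z‖ₑ ^ p ∂Measure.pi (fun _ => normalizedSumLaw m μ) := by
  have hp0 : 0 ≤ p := by linarith
  have hPm : Measurable fun z => ‖P z‖ₑ ^ p := h.continuous.enorm.measurable.pow_const p
  have hs : ((√m : ℝ) : ℂ) ≠ 0 := by simpa using hm
  rw [lintegral_pi_normalizedSumLaw μ hPm]
  refine lintegral_factorial_smul_le _ h hp (fun (w : Fin n → Fin m → ℂ) l i => w i l)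
    (by fun_prop) fun r => ?_
  have hsum : Measurable fun w : Fin n → Fin m → ℂ => ‖P fun i => ∑ l, w i l‖ₑ ^ p :=
    hPm.comp (by fun_prop)
  have hr : MeasurePreserving (fun (w : Fin n → Fin m → ℂ) i l => (r l : ℤ) • w i l)
      (Measure.pi fun _ => Measure.pi fun _ => μ) (Measure.pi fun _ => Measure.pi fun _ => μ) :=
    measurePreserving_pi _ _ fun _ => measurePreserving_pi_zsmul hμ r
  calc _ = ∫⁻ w : Fin n → Fin m → ℂ, ‖P fun i => ∑ l, (r l : ℤ) • w i l‖ₑ ^ p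
        ∂Measure.pi (fun _ => Measure.pi fun _ => μ) := by
        refine lintegral_congr fun w => ?_
        congr 3
        ext i
        simp [Finset.sum_apply]
    _ = ∫⁻ w : Fin n → Fin m → ℂ, ‖P fun i => ∑ l, w i l‖ₑ ^ p
        ∂Measure.pi (fun _ => Measure.pi fun _ => μ) := hr.lintegral_comp hsum
    _ = ∫⁻ w : Fin n → Fin m → ℂ, ((m : ℝ≥0∞) ^ ((m : ℝ) / 2)) ^ p *
        ‖P fun i => normalizedSum m (w i)‖ₑ ^ p
        ∂Measure.pi (fun _ => Measure.pi fun _ => μ) := by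
        refine lintegral_congr fun w => ?_
        have : (fun i => ∑ l, w i l) = ((√m : ℝ) : ℂ) • fun i => normalizedSum m (w i) := by
          ext i
          simp only [Pi.smul_apply, smul_eq_mul, normalizedSum]
          rw [mul_inv_cancel_left₀ hs]
        rw [this, h.map_smul, enorm_smul, enorm_sqrt_pow, ENNReal.mul_rpow_of_nonneg _ _ hp0]
    _ ≤ _ := by
        rw [lintegral_const_mul]
        exact hPm.comp (measurable_pi_lambda _ fun i =>
          (measurable_normalizedSum m).comp (measurable_pi_apply i))

/-- Averaging over cyclic shifts `l ↦ l + c i`, independent in `i`, makes every slot the mean of the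
copies. Each shift preserves the array law, and the normalized sum is `√m` times that mean. -/
theorem lintegral_normalized_le_decoupled {μ : Measure ℂ} [IsProbabilityMeasure μ]
    (hP : IsTetrahedralHomogeneous m P) (h : IsAssociatedSymmetric M P) (hm : m ≠ 0) {p : ℝ}
    (hp : 1 ≤ p) :
    ∫⁻ z, ‖P z‖ₑ ^ p ∂Measure.pi (fun _ => normalizedSumLaw m μ) ≤
      ((m : ℝ≥0∞) ^ ((m : ℝ) / 2)) ^ p *
        ∫⁻ w : Fin n → Fin m → ℂ, ‖M (fun l i => w i l)‖ₑ ^ p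
          ∂Measure.pi (fun _ => Measure.pi fun _ => μ) := by
  have : NeZero m := ⟨hm⟩
  have hp0 : 0 ≤ p := by linarith
  have hPm : Measurable fun z => ‖P z‖ₑ ^ p := h.continuous.enorm.measurable.pow_const p
  have hMm : Measurable fun w : Fin n → Fin m → ℂ => ‖M (fun l i => w i l)‖ₑ :=
    (continuous_multilinear M).enorm.measurable.comp (by fun_prop)
  have hs : ((√m : ℝ) : ℂ) ≠ 0 := by simpa using hm
  have hs2 : ((√m : ℝ) : ℂ) * ((√m : ℝ) : ℂ) = m := by
    rw [← Complex.ofReal_mul, Real.mul_self_sqrt m.cast_nonneg, Complex.ofReal_natCast]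
  rw [lintegral_pi_normalizedSumLaw μ hPm]
  have e : ∀ w : Fin n → Fin m → ℂ, P (fun i => normalizedSum m (w i)) =
      ((√m : ℝ) : ℂ) ^ m • (Fintype.card (Fin n → Fin m) : ℂ)⁻¹ •
        ∑ c : Fin n → Fin m, M (fun l i => w i (l + c i)) := by
    intro w
    rw [multilinear_average hP h (fun i t l => w i (l + t)) (fun i => (m : ℂ)⁻¹ * ∑ l, w i l),
      ← h.map_smul]
    · congr 1
      ext i
      simp only [Pi.smul_apply, smul_eq_mul, normalizedSum]
      rw [← hs2]
      field_simp
    · intro i l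
      rw [Fintype.card_fin]
      congr 1
      exact Equiv.sum_comp (Equiv.addLeft l) (w i)
  simp only [e, enorm_smul _ ((Fintype.card (Fin n → Fin m) : ℂ)⁻¹ • _), enorm_sqrt_pow,
    ENNReal.mul_rpow_of_nonneg _ _ hp0]
  have hshift : ∀ c : Fin n → Fin m,
      MeasurePreserving (fun (w : Fin n → Fin m → ℂ) i l => w i (l + c i))
      (Measure.pi fun _ => Measure.pi fun _ => μ) (Measure.pi fun _ => Measure.pi fun _ => μ) :=
    fun c => measurePreserving_pi _ _ fun i => measurePreserving_arrowCongr' (fun _ => μ)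
      (fun _ => μ) (Equiv.addRight (c i)).symm (MeasurableEquiv.refl ℂ)
      fun _ => MeasurePreserving.id μ
  have hMs : ∀ c : Fin n → Fin m,
      Measurable fun w : Fin n → Fin m → ℂ => ‖M (fun l i => w i (l + c i))‖ₑ :=
    fun c => hMm.comp (hshift c).measurable
  rw [lintegral_const_mul']
  · refine mul_le_mul' le_rfl (lintegral_average_le _ hp
      (fun (c : Fin n → Fin m) (w : Fin n → Fin m → ℂ) => M fun l i => w i (l + c i))
      hMs fun c => le_of_eq ?_)
    exact (hshift c).lintegral_comp (hMm.pow_const p)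
  · exact ENNReal.rpow_ne_top_of_nonneg hp0
      (ENNReal.rpow_ne_top_of_nonneg (by positivity) (ENNReal.natCast_ne_top m))

/-- The quotient is one term of the series of `e ^ m`. -/
theorem pow_self_div_factorial_le (m : ℕ) : (m : ℝ) ^ m / m.factorial ≤ 3 ^ m := by
  calc (m : ℝ) ^ m / m.factorial ≤ ∑ i ∈ Finset.range (m + 1), (m : ℝ) ^ i / i.factorial :=
        Finset.single_le_sum (f := fun i => (m : ℝ) ^ i / i.factorial)
          (fun i _ => by positivity) (Finset.mem_range.2 (Nat.lt_succ_self m))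
    _ ≤ Real.exp m := Real.sum_le_exp_of_nonneg m.cast_nonneg _
    _ = Real.exp 1 ^ m := by rw [← Real.exp_nat_mul, mul_one]
    _ ≤ 3 ^ m := by gcongr; exact Real.exp_one_lt_three.le

/-- The decoupling inequalities for laws with linear domination against their normalized sums. -/
theorem lintegral_decoupling {μ : Measure ℂ} [IsProbabilityMeasure μ]
    (hμ : MeasurePreserving (fun y => -y) μ μ)
    (hμm : MeasurePreserving (fun y => -y) (normalizedSumLaw m μ) (normalizedSumLaw m μ))
    {p : ℝ} (hp : 1 ≤ p) {K : ℝ≥0∞}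
    (hK₁ : ∀ (κ : Type) [Fintype κ] (x : κ → X),
      ∫⁻ y, ‖∑ i, y i • x i‖ₑ ^ p ∂Measure.pi (fun _ : κ => μ) ≤
        K * ∫⁻ y, ‖∑ i, y i • x i‖ₑ ^ p ∂Measure.pi (fun _ : κ => normalizedSumLaw m μ))
    (hK₂ : ∀ (κ : Type) [Fintype κ] (x : κ → X),
      ∫⁻ y, ‖∑ i, y i • x i‖ₑ ^ p ∂Measure.pi (fun _ : κ => normalizedSumLaw m μ) ≤
        K * ∫⁻ y, ‖∑ i, y i • x i‖ₑ ^ p ∂Measure.pi (fun _ : κ => μ))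
    (hP : IsTetrahedralHomogeneous m P) (h : IsAssociatedSymmetric M P) (hm : m ≠ 0) :
    ∫⁻ z, ‖P z‖ₑ ^ p ∂Measure.pi (fun _ => μ) ≤ ((9 : ℝ≥0∞) ^ p * K) ^ m *
      (((m : ℝ≥0∞) ^ ((m : ℝ) / 2)) ^ p * ∫⁻ w : Fin n → Fin m → ℂ, ‖M (fun l i => w i l)‖ₑ ^ p
          ∂Measure.pi (fun _ => Measure.pi fun _ => μ)) ∧
    ((m : ℝ≥0∞) ^ ((m : ℝ) / 2)) ^ p * ∫⁻ w : Fin n → Fin m → ℂ, ‖M (fun l i => w i l)‖ₑ ^ p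
          ∂Measure.pi (fun _ => Measure.pi fun _ => μ) ≤
      ((9 : ℝ≥0∞) ^ p * K) ^ m * ∫⁻ z, ‖P z‖ₑ ^ p ∂Measure.pi (fun _ => μ) := by
  have hp0 : 0 ≤ p := by linarith
  set D : ℝ≥0∞ := ENNReal.ofReal ((m : ℝ) ^ m / m.factorial) with hD
  have hD3 : D ≤ 3 ^ m := by
    refine (ENNReal.ofReal_le_ofReal (pow_self_div_factorial_le m)).trans (le_of_eq ?_)
    rw [ENNReal.ofReal_pow (by norm_num), ENNReal.ofReal_ofNat]
  have hDp : D ^ p * D ^ p ≤ ((9 : ℝ≥0∞) ^ p) ^ m := by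
    rw [← ENNReal.mul_rpow_of_nonneg _ _ hp0, ← ENNReal.rpow_mul_natCast, mul_comm p,
      ENNReal.rpow_natCast_mul]
    refine ENNReal.rpow_le_rpow ((mul_le_mul' hD3 hD3).trans (le_of_eq ?_)) hp0
    rw [← mul_pow]; norm_num
  have hDp1 : D ^ p ≤ ((9 : ℝ≥0∞) ^ p) ^ m := by
    rw [← ENNReal.rpow_mul_natCast, mul_comm p, ENNReal.rpow_natCast_mul]
    refine ENNReal.rpow_le_rpow (hD3.trans ?_) hp0
    gcongr
    norm_num
  set T : ℝ≥0∞ := (m : ℝ≥0∞) ^ ((m : ℝ) / 2) with hT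
  set N := ∫⁻ w : Fin n → Fin m → ℂ, ‖M (fun l i => w i l)‖ₑ ^ p
          ∂Measure.pi (fun _ => Measure.pi fun _ => μ) with hN
  set A := ∫⁻ z, ‖P z‖ₑ ^ p ∂Measure.pi (fun _ => μ) with hA
  set G := ∫⁻ z, ‖P z‖ₑ ^ p ∂Measure.pi (fun _ => normalizedSumLaw m μ) with hG
  have h1 : A ≤ D ^ p * K ^ m * G := lintegral_polynomial_le hμm hp hK₁ hP h hm
  have h2 : G ≤ D ^ p * K ^ m * A := lintegral_polynomial_le hμ hp hK₂ hP h hm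
  have h3 : G ≤ T ^ p * N := lintegral_normalized_le_decoupled hP h hm hp
  have h4 : (m.factorial : ℝ≥0∞) ^ p * N ≤ T ^ p * G := by
    have := lintegral_factorial_decoupled_le hμ h hm hp
    simp only [enorm_smul, ENNReal.mul_rpow_of_nonneg _ _ hp0] at this
    rw [lintegral_const_mul' _ _ (ENNReal.rpow_ne_top_of_nonneg hp0 enorm_ne_top),
      show ‖(m.factorial : ℂ)‖ₑ = (m.factorial : ℝ≥0∞) by rw [← ofReal_norm]; simp] at this
    exact this
  -- Both sides equal `m ^ m`; this trades the factorial on the decoupled side for the normalization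
  -- `T`.
  have hTT : T * T = D * m.factorial := by
    rw [hT, ← ENNReal.rpow_add_of_nonneg _ _ (by positivity) (by positivity), add_halves,
      ENNReal.rpow_natCast, hD, ← ENNReal.ofReal_natCast m.factorial,
      ← ENNReal.ofReal_mul (by positivity), div_mul_cancel₀ _ (by positivity),
      ENNReal.ofReal_pow (by positivity), ENNReal.ofReal_natCast]
  have h5 : T ^ p * N ≤ D ^ p * G := by
    have hf0 : (m.factorial : ℝ≥0∞) ^ p ≠ 0 := by
      simp [ENNReal.rpow_eq_zero_iff, m.factorial_ne_zero]
    have hft : (m.factorial : ℝ≥0∞) ^ p ≠ ∞ :=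
      ENNReal.rpow_ne_top_of_nonneg hp0 (ENNReal.natCast_ne_top _)
    rw [← ENNReal.mul_le_mul_iff_right hf0 hft]
    calc (m.factorial : ℝ≥0∞) ^ p * (T ^ p * N) = T ^ p * ((m.factorial : ℝ≥0∞) ^ p * N) := by ring
      _ ≤ T ^ p * (T ^ p * G) := by gcongr
      _ = (T * T) ^ p * G := by rw [ENNReal.mul_rpow_of_nonneg _ _ hp0]; ring
      _ = _ := by rw [hTT, ENNReal.mul_rpow_of_nonneg _ _ hp0]; ring
  constructor
  · calc A ≤ D ^ p * K ^ m * G := h1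
      _ ≤ ((9 : ℝ≥0∞) ^ p) ^ m * K ^ m * (T ^ p * N) := by gcongr
      _ = _ := by rw [mul_pow]
  · calc T ^ p * N ≤ D ^ p * G := h5
      _ ≤ D ^ p * (D ^ p * K ^ m * A) := by gcongr
      _ = D ^ p * D ^ p * K ^ m * A := by ring
      -- The factor `D ≤ 3 ^ m` enters twice, through polarization and through the change of law;
      -- hence `9`.
      _ ≤ ((9 : ℝ≥0∞) ^ p) ^ m * K ^ m * A := by gcongr
      _ = _ := by rw [mul_pow]

end Decoupling

/-! ### Passage from the random variables to their laws, and conclusion. -/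

theorem exists_symmetricLaw_map {Ω₀ : Type*} [MeasurableSpace Ω₀] {μ₀ : Measure Ω₀}
    [IsProbabilityMeasure μ₀] {ξ₀ : Ω₀ → ℂ}
    (hsymm : IdentDistrib ξ₀ (fun ω => -ξ₀ ω) μ₀ μ₀) (hnontriv : ¬ ∀ᵐ ω ∂μ₀, ξ₀ ω = 0)
    {s : ℝ} (hs : 1 ≤ s) (hmoment : MemLp ξ₀ (ENNReal.ofReal s) μ₀) :
    ∃ B c : ℝ, 0 < B ∧ 0 < c ∧ SymmetricLaw s B c (μ₀.map ξ₀) := by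
  have hm : AEMeasurable ξ₀ μ₀ := hsymm.aemeasurable_fst
  have hs0 : 0 < s := by linarith
  have hV : ∫⁻ ω, ‖ξ₀ ω‖ₑ ^ s ∂μ₀ < ∞ := by
    have := hmoment.2
    rwa [eLpNorm_lt_top_iff_lintegral_rpow_enorm_lt_top (by simpa using hs0) (by simp),
      ENNReal.toReal_ofReal hs0.le] at this
  have h1 : ∫⁻ ω, ‖ξ₀ ω‖ₑ ∂μ₀ < ∞ :=
    (hmoment.integrable (by rw [ENNReal.one_le_ofReal]; exact hs)).2
  have h0 : ∫⁻ ω, ‖ξ₀ ω‖ₑ ∂μ₀ ≠ 0 := by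
    rw [Ne, lintegral_eq_zero_iff' hm.enorm]
    intro h
    exact hnontriv (h.mono fun ω hω => by simpa using hω)
  set V := (∫⁻ ω, ‖ξ₀ ω‖ₑ ^ s ∂μ₀).toReal with hVdef
  have hV0 : 0 ≤ V := ENNReal.toReal_nonneg
  refine ⟨(V + 1) ^ s⁻¹, (∫⁻ ω, ‖ξ₀ ω‖ₑ ∂μ₀).toReal, by positivity,
    ENNReal.toReal_pos h0 h1.ne, ⟨measurable_neg, ?_⟩, ?_, ?_⟩
  · rw [AEMeasurable.map_map_of_aemeasurable measurable_neg.aemeasurable hm]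
    exact hsymm.map_eq.symm
  · rw [lintegral_map' (by fun_prop) hm, ← Real.rpow_mul (by positivity), inv_mul_cancel₀ hs0.ne',
      Real.rpow_one]
    exact (ENNReal.ofReal_toReal hV.ne).symm.le.trans (ENNReal.ofReal_le_ofReal (by linarith))
  · rw [lintegral_map' (by fun_prop) hm, ENNReal.ofReal_toReal h1.ne]

theorem exists_hasCotype_lt {X : Type*} [NormedAddCommGroup X] (hX : HasFiniteCotype X) {s : ℝ}
    (hs : cot X < s) : ∃ q, HasCotype X q ∧ q < s := by
  obtain ⟨q, hq, hqs⟩ := exists_lt_of_csInf_lt (show {q : ℝ | HasCotype X q}.Nonempty from hX) hs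
  exact ⟨q, hq, hqs⟩

/-- The array law of the independent copies, grouped by coordinates. -/
theorem map_array_eq_pi {Ω : Type*} [MeasurableSpace Ω] {μ : Measure Ω} [IsProbabilityMeasure μ]
    {m n : ℕ} {ξc : Fin m → Fin n → Ω → ℂ} {ρ : Measure ℂ} [IsProbabilityMeasure ρ]
    (hm : ∀ l i, AEMeasurable (ξc l i) μ) (hρ : ∀ l i, μ.map (ξc l i) = ρ)
    (hind : iIndepFun (fun k : Fin m × Fin n => ξc k.1 k.2) μ) :
    μ.map (fun ω (i : Fin n) (l : Fin m) => ξc l i ω) =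
      Measure.pi fun _ => Measure.pi fun _ => ρ := by
  have h1 : iIndepFun (fun k : Fin n × Fin m => ξc k.2 k.1) μ :=
    hind.precomp (g := Prod.swap) Prod.swap_injective
  have h2 := h1.map_fun_eq_pi_map fun k : Fin n × Fin m => hm k.2 k.1
  simp only [hρ] at h2
  have h3 := Measure.infinitePi_map_curry (ι := Fin n) (κ := Fin m) fun _ _ => ρ
  simp only [Measure.infinitePi_eq_pi] at h3
  have hmeas : AEMeasurable (fun ω (k : Fin n × Fin m) => ξc k.2 k.1 ω) μ :=
    aemeasurable_pi_lambda _ fun k => hm k.2 k.1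
  rw [← h3, ← h2, AEMeasurable.map_map_of_aemeasurable
    (MeasurableEquiv.measurable _).aemeasurable hmeas]
  rfl

theorem theorem2p1
    {X : Type*} [NormedAddCommGroup X] [NormedSpace ℂ X] [CompleteSpace X]
    (hX : HasFiniteCotype X)
    {Ω₀ : Type*} [MeasurableSpace Ω₀] (μ₀ : Measure Ω₀) [IsProbabilityMeasure μ₀]
    (ξ₀ : Ω₀ → ℂ)
    (hsymm : IdentDistrib ξ₀ (fun ω => -ξ₀ ω) μ₀ μ₀)
    (hnontriv : ¬ ∀ᵐ ω ∂μ₀, ξ₀ ω = 0)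
    (s : ℝ) (hs : cot X < s) (hmoment : MemLp ξ₀ (ENNReal.ofReal s) μ₀)
    (p : ℝ) (hp : 1 ≤ p) (hps : p < s) :
    ∃ C : ℝ≥0, 1 ≤ C ∧
      ∀ (m n : ℕ) (P : (Fin n → ℂ) → X) (M : MultilinearMap ℂ (fun _ : Fin m => Fin n → ℂ) X),
        IsTetrahedralHomogeneous m P → IsAssociatedSymmetric M P →
        ∀ {Ω : Type*} [MeasurableSpace Ω] (μ : Measure Ω) [IsProbabilityMeasure μ]
          -- `ξ` is the random vector, `ξc l` for `l : Fin m` are its `m` independent copies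
          (ξ : Fin n → Ω → ℂ) (ξc : Fin m → Fin n → Ω → ℂ),
          (∀ i, IdentDistrib (ξ i) ξ₀ μ μ₀) →
          (∀ l i, IdentDistrib (ξc l i) ξ₀ μ μ₀) →
          iIndepFun (Sum.elim ξ (fun k : Fin m × Fin n => ξc k.1 k.2)) μ →
          EquivUpTo ((C : ℝ≥0∞) ^ m)
            (eLpNorm (fun ω => P (fun i => ξ i ω)) (ENNReal.ofReal p) μ)
            ((m : ℝ≥0∞) ^ ((m : ℝ) / 2) *
              eLpNorm (fun ω => M (fun l i => ξc l i ω)) (ENNReal.ofReal p) μ) := by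
  have hp0 : 0 < p := by linarith
  obtain ⟨q, hq, hqs⟩ := exists_hasCotype_lt hX hs
  have hs2 : 2 ≤ s := hq.1.trans hqs.le
  obtain ⟨B₀, c₀, hB₀, hc₀, hlaw₀⟩ :=
    exists_symmetricLaw_map hsymm hnontriv (by linarith) hmoment
  obtain ⟨B, c, hB, hc, hlaw⟩ := exists_symmetricLaw_normalizedSum hs2 hB₀ hc₀
  obtain ⟨K, hK⟩ := exists_linear_domination hq hqs hp hps hB hc
  have hρ : IsProbabilityMeasure (μ₀.map ξ₀) :=
    Measure.isProbabilityMeasure_map hsymm.aemeasurable_fst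
  set ρ := μ₀.map ξ₀
  obtain ⟨hρlaw, hρm⟩ := hlaw ρ hlaw₀
  -- The `p`-th root of `9 ^ p * K`, with `K` raised to at least `1` so that the constant is too.
  refine ⟨9 * (max K 1) ^ (1 / p), ?_, fun m n P M hP hM Ω _ μ _ ξ ξc hξ hξc hind => ?_⟩
  · exact one_le_mul (by norm_num) (NNReal.one_le_rpow (le_max_right _ _) (by positivity))
  -- Degree `0` is separate: the normalization by `√m` degenerates, while both sides are the same
  -- constant.
  rcases eq_or_ne m 0 with rfl | hm
  · have e : (fun ω => M fun l i => ξc l i ω) = fun ω => P fun i => ξ i ω := by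
      ext ω
      rw [← hM.2]
      congr 1
      exact Subsingleton.elim _ _
    simp [EquivUpTo, e]
  have hPm : Measurable fun z => ‖P z‖ₑ ^ p := hM.continuous.enorm.measurable.pow_const p
  have hMm : Measurable fun w : Fin n → Fin m → ℂ => ‖M (fun l i => w i l)‖ₑ ^ p :=
    ((continuous_multilinear M).enorm.measurable.comp (by fun_prop)).pow_const p
  have e1 : ∫⁻ ω, ‖P (fun i => ξ i ω)‖ₑ ^ p ∂μ =
      ∫⁻ z, ‖P z‖ₑ ^ p ∂Measure.pi (fun _ => ρ) := by
    have h1 : iIndepFun ξ μ := hind.precomp (g := Sum.inl) Sum.inl_injective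
    have h2 := h1.map_fun_eq_pi_map fun i => (hξ i).aemeasurable_fst
    simp only [fun i => (hξ i).map_eq] at h2
    rw [← h2, lintegral_map' hPm.aemeasurable
      (aemeasurable_pi_lambda _ fun i => (hξ i).aemeasurable_fst)]
  have e2 : ∫⁻ ω, ‖M (fun l i => ξc l i ω)‖ₑ ^ p ∂μ =
      ∫⁻ w : Fin n → Fin m → ℂ, ‖M (fun l i => w i l)‖ₑ ^ p
        ∂Measure.pi (fun _ => Measure.pi fun _ => ρ) := by
    have h1 : iIndepFun (fun k : Fin m × Fin n => ξc k.1 k.2) μ :=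
      hind.precomp (g := Sum.inr) Sum.inr_injective
    rw [← map_array_eq_pi (fun l i => (hξc l i).aemeasurable_fst) (fun l i => (hξc l i).map_eq) h1,
      lintegral_map' hMm.aemeasurable (aemeasurable_pi_lambda _ fun i =>
        aemeasurable_pi_lambda _ fun l => (hξc l i).aemeasurable_fst)]
  have hsum := hρm m hm
  obtain ⟨h1, h2⟩ := lintegral_decoupling (n := n) hρlaw.neg hsum.neg hp (K := K)
    (fun κ _ x => hK ρ _ hρlaw hsum κ x) (fun κ _ x => hK _ ρ hsum hρlaw κ x) hP hM hm
  rw [← e1, ← e2] at h1 h2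
  have hroot : ∀ {a b : ℝ≥0∞}, a ≤ ((9 : ℝ≥0∞) ^ p * K) ^ m * b →
      a ^ (1 / p) ≤ ((9 * (max K 1) ^ (1 / p) : ℝ≥0) : ℝ≥0∞) ^ m * b ^ (1 / p) := by
    intro a b hab
    refine (ENNReal.rpow_le_rpow hab (by positivity)).trans ?_
    rw [ENNReal.mul_rpow_of_nonneg _ _ (by positivity)]
    gcongr
    rw [← ENNReal.rpow_natCast_mul, mul_comm (m : ℝ), ENNReal.rpow_mul_natCast]
    gcongr
    rw [ENNReal.mul_rpow_of_nonneg _ _ (by positivity), ← ENNReal.rpow_mul,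
      mul_one_div_cancel hp0.ne', ENNReal.rpow_one, ENNReal.coe_mul,
      ENNReal.coe_rpow_of_nonneg _ (by positivity)]
    gcongr
    · simp
    · exact le_max_left _ _
  have e3 : ∀ t b : ℝ≥0∞, (t ^ p * b) ^ (1 / p) = t * b ^ (1 / p) := by
    intro t b
    rw [ENNReal.mul_rpow_of_nonneg _ _ (by positivity), ← ENNReal.rpow_mul,
      mul_one_div_cancel hp0.ne', ENNReal.rpow_one]
  have h1' := hroot h1
  have h2' := hroot h2
  rw [e3] at h1' h2'
  have hpne : ENNReal.ofReal p ≠ 0 := by simpa using hp0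
  rw [EquivUpTo, eLpNorm_eq_lintegral_rpow_enorm_toReal hpne ENNReal.ofReal_ne_top,
    eLpNorm_eq_lintegral_rpow_enorm_toReal hpne ENNReal.ofReal_ne_top,
    ENNReal.toReal_ofReal hp0.le]
  exact ⟨ENNReal.inv_mul_le_iff (by positivity) (ENNReal.pow_ne_top ENNReal.coe_ne_top) |>.2 h1', h2'⟩
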